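/- **Theorem.** An $n$-permutation $p=p_1p_2\cdots p_n$ (an ordering of $1,\dots,n$) is called *indecomposable* if there is no $c$ with $1\le c<n$ such that $p_i>p_j$ for all $i\le c<j$. It *avoids 1342* if there are no indices $a<b<c<d$ with $p_a<p_d<p_b<p_c$. A *$\beta(0,1)$-tree* is a rooted plane tree with a nonnegative integer label on each vertex such that every leaf has label $0$, the label of the root is the sum of the labels of its children, and the label of every vertex other than the root and the leaves is at most one more than the sum of the labels of its children. For every $n\ge 1$ there is a bijection between the set of indecomposable 1342-avoiding $n$-permutations and the set of $\beta(0,1)$-trees on $n$ vertices. Both sets have exactly one element if $n=1$, and for every $n\ge 2$ the number of elements of each of them is $$3\cdot 2^{n-2}\cdot\frac{(2n-2)!}{(n+1)!\,(n-1)!}.$$ (In other words, with $t_m=3\cdot 2^{m-1}\frac{(2m)!}{(m+2)!\,m!}$ for $m\ge 1$, it is $t_{n-1}$.) -/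

import Mathlib

open scoped Nat

/-- The permutation `p` contains the pattern `q`: some subsequence of `p` is ordered like `q`. -/
def ContainsPattern {k n : ℕ} (q : Equiv.Perm (Fin k)) (p : Equiv.Perm (Fin n)) : Prop :=
  ∃ f : Fin k → Fin n, StrictMono f ∧ ∀ i j : Fin k, p (f i) < p (f j) ↔ q i < q j

/-- The permutation `p` avoids the pattern `q`. -/
def AvoidsPattern {k n : ℕ} (q : Equiv.Perm (Fin k)) (p : Equiv.Perm (Fin n)) : Prop :=
  ¬ ContainsPattern q p

/-- The pattern `1342`, written with the entries `0, 2, 3, 1` of `Fin 4`. -/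
def pattern1342 : Equiv.Perm (Fin 4) where
  toFun := ![0, 2, 3, 1]
  invFun := ![0, 3, 1, 2]
  left_inv := by decide
  right_inv := by decide

/-- `p` cannot be cut into two nonempty parts such that every entry before the cut is larger than
every entry after the cut. -/
def IsIndecomposable {n : ℕ} (p : Equiv.Perm (Fin n)) : Prop :=
  ¬ ∃ c : ℕ, 0 < c ∧ c < n ∧ ∀ i j : Fin n, (i : ℕ) < c → c ≤ (j : ℕ) → p j < p i

/-- Rooted plane trees with a nonnegative integer label on each vertex: the root carries the given
label, and its branches are given in their order from left to right. -/
inductive LabeledPlaneTree : Type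
  | node (label : ℕ) (branches : List LabeledPlaneTree) : LabeledPlaneTree

namespace LabeledPlaneTree

/-- The label of the root. -/
def rootLabel : LabeledPlaneTree → ℕ
  | node l _ => l

/-- The number of vertices. -/
def numVertices : LabeledPlaneTree → ℕ
  | node _ ts => 1 + (ts.map numVertices).sum

/-- The label conditions at all vertices of a tree that hangs below a vertex of a larger tree:
leaves are labelled `0`, and the label of every other vertex is at most one more than the sum of
the labels of its children. -/
inductive IsNonrootAdmissible : LabeledPlaneTree → Prop
  | leaf : IsNonrootAdmissible (node 0 [])
  | internal (l : ℕ) (ts : List LabeledPlaneTree) (hne : ts ≠ [])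
      (hl : l ≤ 1 + (ts.map rootLabel).sum) (hts : ∀ t ∈ ts, IsNonrootAdmissible t) :
      IsNonrootAdmissible (node l ts)

/-- `β(0,1)`-trees: the label of the root is the sum of the labels of its children (so it is `0` if
the root is a leaf), every other leaf has label `0`, and the label of every other vertex is at most
one more than the sum of the labels of its children. -/
def IsBeta01 : LabeledPlaneTree → Prop
  | node l ts => l = (ts.map rootLabel).sum ∧ ∀ t ∈ ts, IsNonrootAdmissible t

end LabeledPlaneTree

/-- The set of indecomposable `n`-permutations that avoid `1342`. -/
def indecomposable1342Avoiders (n : ℕ) : Set (Equiv.Perm (Fin n)) :=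
  {p | IsIndecomposable p ∧ AvoidsPattern pattern1342 p}

/-- The set of `β(0,1)`-trees on `n` vertices. -/
def beta01Trees (n : ℕ) : Set LabeledPlaneTree :=
  {T | T.IsBeta01 ∧ T.numVertices = n}

/-!
Both sets are counted by the coefficients of one algebraic series.  With `T = X + 2 T²` this is
`(1 - 3 T + T²) / (1 - 2 T)²` (`BicubicSeries.series`), whose coefficients are read off from the
differential equation of `(1 - 4 T)³ = (1 - 8 X) ^ (3 / 2)` (`BicubicSeries.coeff_series`).  The
bijection then exists because the two finite sets have the same number of elements.

*Permutations.*  A permutation that avoids `1342` is built by appending entries at the end.  Call a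
slot between consecutive values active if an entry appended there creates no `1342`.  The active
slots, together with the relation that the values between two slots all precede the values below
the lower one (`SlotCut`), determine how both develop when an entry is appended.  They form a list
of blocks, one for each skew-indecomposable component, and each block is a list of chains
(`SlotState.IsStateOf`); the permutation is indecomposable exactly if there is a single block.
Appending an entry in a slot `v` discards the slots below `v` that are not cuts of `v`, joins the
cuts into one chain ending in `v`, and splits `v` in two (`SlotState.IsStateOf.pick`).  In this
generating tree the series of all continuations of a state is a product over its chains, up to
corrections for the blocks above (`SlotState.weight`), provided the weights `P` and `K` of chains
satisfy `K e = P (e + 1) + x P 1 K (e + 1)` and `P d = 1 + x ∑_{e < d} K e P (d - e)`.  These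
equations have an explicit solution, algebraic over `T`, with `P 1` the series above
(`BicubicSeries.exists_weights`), and comparing coefficients gives the count.

*Trees.*  Splitting off the first branch of the root shows that the series of `β(0,1)`-trees, with
`u` marking the root label, satisfies
`(1 - u) (Ψ - 1) = X Ψ (Ψ(1) - u + u² - u² Ψ)` (`BicubicSeries.TreeEquation`).  Written in powers of
`t = u - 1`, this equation has only one power series solution
(`BicubicSeries.TreeEquation.unique`), and an explicit one is found by solving the quadratic
equation, whose discriminant has a double root in `u` (`BicubicSeries.exists_treeEquation`).
-/

/-! ### Quadratic equations over power series -/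

section Quadratic

open PowerSeries

/-- The equation `y = a + X b y²` is solved by `a · C(X a b)`, where `C` is the Catalan series. -/
theorem PowerSeries.exists_eq_add_X_mul_sq {A : Type*} [CommRing A] (a b : A⟦X⟧) :
    ∃ y : A⟦X⟧, y = a + X * b * y ^ 2 := by
  have hs : PowerSeries.HasSubst (X * a * b : A⟦X⟧) :=
    PowerSeries.HasSubst.of_constantCoeff_zero' (by simp)
  let c : ℤ⟦X⟧ := PowerSeries.map (Nat.castRingHom ℤ) catalanSeries
  have hc : c = 1 + X * c ^ 2 := by
    have h := congrArg (PowerSeries.map (Nat.castRingHom ℤ)) catalanSeries_sq_mul_X_add_one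
    simp only [map_add, map_mul, map_pow, map_one, PowerSeries.map_X] at h
    change c ^ 2 * X + 1 = c at h
    linear_combination -h
  have h := congrArg (PowerSeries.substAlgHom hs) hc
  simp only [map_add, map_mul, map_pow, map_one, PowerSeries.substAlgHom_X] at h
  generalize PowerSeries.substAlgHom hs c = d at h
  change A⟦X⟧ at d
  refine ⟨a * d, ?_⟩
  have h' : d = 1 + X * a * b * d ^ 2 := h
  linear_combination a * h'

end Quadratic

/-! ### The algebraic parametrization of the counting series -/

namespace BicubicSeries

open PowerSeries

/-- The series `τ` with `τ = 1 + 2 X τ²`. -/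
noncomputable def tau : ℚ⟦X⟧ := (exists_eq_add_X_mul_sq (1 : ℚ⟦X⟧) 2).choose

/-- The parameter `T = X τ`, the power series with `T = X + 2 T²`. -/
noncomputable def param : ℚ⟦X⟧ := X * tau

/-- The series `(1 - 3 T + T²) / (1 - 2 T)²`.  Its coefficient at `X ^ (n - 1)` is the number of
objects of size `n` in both families. -/
noncomputable def series : ℚ⟦X⟧ := (1 - 3 * param + param ^ 2) * ((1 - 2 * param) ^ 2)⁻¹

theorem tau_eq : tau = 1 + 2 * X * tau ^ 2 := by
  have h := (exists_eq_add_X_mul_sq (1 : ℚ⟦X⟧) 2).choose_spec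
  change tau = 1 + X * 2 * tau ^ 2 at h
  linear_combination h

theorem param_eq : param = X * tau := rfl

theorem X_eq : (X : ℚ⟦X⟧) = param * (1 - 2 * param) := by
  rw [param_eq]; linear_combination -X * tau_eq

@[simp] theorem constantCoeff_param : constantCoeff param = 0 := by simp [param_eq]

theorem tau_mul : tau * (1 - 2 * param) = 1 := by
  rw [param_eq]; linear_combination tau_eq

theorem isUnit_one_sub_two_param : IsUnit (1 - 2 * param) :=
  IsUnit.of_mul_eq_one _ (by rw [mul_comm]; exact tau_mul)

theorem series_mul : series * (1 - 2 * param) ^ 2 = 1 - 3 * param + param ^ 2 := by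
  rw [series, mul_assoc, PowerSeries.inv_mul_cancel, mul_one]
  simp

theorem constantCoeff_series : constantCoeff series = 1 := by
  have h := congrArg constantCoeff series_mul
  simpa using h

theorem one_sub_four_param_cube :
    (1 - 4 * param) ^ 3 = 1 - 12 * X + 24 * X ^ 2 + 32 * (X ^ 2 * (series - 1)) := by
  have h := series_mul
  rw [X_eq]
  linear_combination (-32 * param ^ 2) * h

theorem derivative_param : d⁄dX ℚ param * (1 - 4 * param) = 1 := by
  have h := congrArg (d⁄dX ℚ) (show param = X + (2 : ℕ) • (param * param) by
    rw [nsmul_eq_mul]; push_cast; linear_combination -X_eq)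
  rw [map_add, map_nsmul, Derivation.leibniz, derivative_X, nsmul_eq_mul] at h
  simp only [smul_eq_mul] at h
  push_cast at h
  linear_combination h

theorem differential_equation :
    (1 - 8 * X) * d⁄dX ℚ ((1 - 4 * param) ^ 3) = -12 * (1 - 4 * param) ^ 3 := by
  have h : d⁄dX ℚ ((1 - 4 * param) ^ 3) = -12 * (1 - 4 * param) ^ 2 * d⁄dX ℚ param := by
    have h4 : d⁄dX ℚ (1 - 4 * param) = -4 * d⁄dX ℚ param := by
      have : (1 - 4 * param : ℚ⟦X⟧) = 1 - (4 : ℕ) • param := by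
        rw [nsmul_eq_mul]; push_cast; ring
      rw [this, map_sub, map_nsmul, Derivation.map_one_eq_zero, nsmul_eq_mul]
      push_cast; ring
    rw [Derivation.leibniz_pow, h4]
    simp only [smul_eq_mul, nsmul_eq_mul]
    push_cast; ring
  rw [h]
  have hX := X_eq
  have hd := derivative_param
  linear_combination (-12 * (1 - 4 * param) ^ 3) * hd +
    (96 * (1 - 4 * param) ^ 2 * d⁄dX ℚ param) * hX

/-- The differential equation of `(1 - 4 T)³`, coefficient by coefficient. -/
theorem coeff_succ_cube (n : ℕ) :
    coeff (n + 1) ((1 - 4 * param) ^ 3) * ((n : ℚ) + 1) =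
      (8 * (n : ℚ) - 12) * coeff n ((1 - 4 * param) ^ 3) := by
  have h := congrArg (coeff n) differential_equation
  have e1 : (1 - 8 * X) * d⁄dX ℚ ((1 - 4 * param) ^ 3) =
      d⁄dX ℚ ((1 - 4 * param) ^ 3) - C 8 * (X * d⁄dX ℚ ((1 - 4 * param) ^ 3)) := by
    rw [show (C 8 : ℚ⟦X⟧) = 8 from map_ofNat C 8]; ring
  have e2 : -12 * (1 - 4 * param) ^ 3 = C (-12) * (1 - 4 * param) ^ 3 := by
    rw [map_neg, show (C 12 : ℚ⟦X⟧) = 12 from map_ofNat C 12]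
  rw [e1, e2, map_sub, coeff_C_mul, coeff_C_mul, coeff_derivative] at h
  cases n with
  | zero => simp at h ⊢; linarith
  | succ n =>
    rw [coeff_succ_X_mul, coeff_derivative] at h
    push_cast at h ⊢
    linarith

theorem coeff_cube_add_two (m : ℕ) (hm : 1 ≤ m) :
    coeff (m + 2) ((1 - 4 * param) ^ 3) = 32 * coeff m series := by
  have e : (1 - 12 * X + 24 * X ^ 2 + 32 * (X ^ 2 * (series - 1)) : ℚ⟦X⟧) =
      1 - C 12 * X + C 24 * X ^ 2 + C 32 * (X ^ 2 * (series - 1)) := by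
    rw [show (C 12 : ℚ⟦X⟧) = 12 from map_ofNat C 12, show (C 24 : ℚ⟦X⟧) = 24 from map_ofNat C 24,
      show (C 32 : ℚ⟦X⟧) = 32 from map_ofNat C 32]
  rw [one_sub_four_param_cube, e]
  simp only [map_add, map_sub, coeff_C_mul, coeff_X_pow, coeff_X, coeff_one]
  rw [coeff_X_pow_mul, map_sub, coeff_one]
  have h2 : ¬ (m + 2 = 1) := by omega
  have h4 : ¬ (m = 0) := by omega
  simp [h2, h4]

theorem coeff_series (m : ℕ) :
    coeff (m + 1) series =
      3 * 2 ^ m * ((2 * (m + 1))! : ℚ) / (((m + 3)! : ℚ) * ((m + 1)! : ℚ)) := by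
  induction m with
  | zero =>
    have h0 := coeff_succ_cube 0
    have h1 := coeff_succ_cube 1
    have h2 := coeff_succ_cube 2
    have h3 := coeff_cube_add_two 1 le_rfl
    have hc : coeff 0 ((1 - 4 * param) ^ 3) = 1 := by simp
    rw [hc] at h0
    norm_num at h0 h1 h2 h3
    rw [h0] at h1
    norm_num [Nat.factorial]
    linarith
  | succ m ih =>
    have h := coeff_succ_cube (m + 3)
    rw [show m + 3 + 1 = m + 2 + 2 from rfl, coeff_cube_add_two _ (by omega),
      show m + 3 = m + 1 + 2 from rfl, coeff_cube_add_two _ (by omega), ih] at h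
    have hm : ((m : ℚ) + 4) ≠ 0 := by positivity
    have hf1 : ((m + 3)! : ℚ) ≠ 0 := by positivity
    have hf2 : ((m + 1)! : ℚ) ≠ 0 := by positivity
    have key : coeff (m + 1 + 1) series * (m + 4) = (8 * m + 12) *
        (3 * 2 ^ m * ((2 * (m + 1))! : ℚ) / (((m + 3)! : ℚ) * ((m + 1)! : ℚ))) := by
      push_cast at h
      linear_combination h / 32
    have key2 : coeff (m + 1 + 1) series = (8 * m + 12) *
        (3 * 2 ^ m * ((2 * (m + 1))! : ℚ) / (((m + 3)! : ℚ) * ((m + 1)! : ℚ))) / (m + 4) := by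
      rw [eq_div_iff hm, key]
    rw [key2, show 2 * (m + 1 + 1) = (2 * (m + 1) + 1) + 1 by ring,
      show m + 1 + 3 = m + 3 + 1 by ring,
      Nat.factorial_succ (2 * (m + 1) + 1), Nat.factorial_succ (2 * (m + 1)),
      Nat.factorial_succ (m + 3), Nat.factorial_succ (m + 1)]
    push_cast
    have hm2 : ((m : ℚ) + 1 + 1) ≠ 0 := by positivity
    have hm3 : ((m : ℚ) + 3 + 1) ≠ 0 := by positivity
    field_simp
    ring

end BicubicSeries

namespace BicubicSeries

open PowerSeries

/-- A bivariate power series with constant term `1` is invertible. -/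
theorem isUnit_of_constantCoeff_constantCoeff {a : ℚ⟦X⟧⟦X⟧}
    (h : constantCoeff (constantCoeff a) = 1) : IsUnit a := by
  rw [PowerSeries.isUnit_iff_constantCoeff, PowerSeries.isUnit_iff_constantCoeff, h]
  exact isUnit_one

/-- The generating series `p = ∑ P (d + 1) u ^ d` and `k = ∑ K e u ^ e` of the weights of chains.
With `w (1 - w) (1 - u) = T (1 - T)` they are
`X p = w (1 - 2 T - (1 - T) w) / (1 - T - w)` and
`X k = w (1 - 3 T + T² - (1 - 2 T) w) / ((1 - T) (1 - 2 T - (1 - T) w))`. -/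
theorem exists_weight_series : ∃ p k : ℚ⟦X⟧⟦X⟧, constantCoeff p = series ∧
    p * (1 - X) = 1 + C X * p * k * (1 - X) ∧
    X * k = X * p + C (X * series) * (k - C (constantCoeff k)) := by
  obtain ⟨z, hz⟩ : ∃ z : ℚ⟦X⟧⟦X⟧, z * (1 - X) = 1 := ⟨_, PowerSeries.mk_one_mul_one_sub_eq_one _⟩
  obtain ⟨y, hy⟩ := exists_eq_add_X_mul_sq (C ((1 - param) * tau) * z) (C (param * tau))
  have h1 : C tau * (1 - 2 * C param) = (1 : ℚ⟦X⟧⟦X⟧) := by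
    have := congrArg (C (R := ℚ⟦X⟧)) tau_mul
    simpa only [map_mul, map_sub, map_one, map_ofNat] using this
  have h2 : C X * C tau = (C param : ℚ⟦X⟧⟦X⟧) := by rw [← map_mul, ← param_eq]
  have h3 : C series * (1 - 2 * C param) ^ 2 = (1 - 3 * C param + C param ^ 2 : ℚ⟦X⟧⟦X⟧) := by
    have := congrArg (C (R := ℚ⟦X⟧)) series_mul
    simpa only [map_mul, map_sub, map_add, map_pow, map_one, map_ofNat] using this
  have h4 : C X = (C param * (1 - 2 * C param) : ℚ⟦X⟧⟦X⟧) := by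
    have := congrArg (C (R := ℚ⟦X⟧)) X_eq
    simpa only [map_mul, map_sub, map_one, map_ofNat] using this
  simp only [map_mul, map_sub, map_one] at hy ⊢
  have hT0 : constantCoeff (constantCoeff (C param : ℚ⟦X⟧⟦X⟧)) = 0 := by simp
  generalize hT : (C param : ℚ⟦X⟧⟦X⟧) = T at *
  -- `w` is the root of `w (1 - w) (1 - u) = T (1 - T)` with `w = T` at `u = 0`.
  set w : ℚ⟦X⟧⟦X⟧ := T * (1 + X * y) with hw
  have hwT : constantCoeff w = param := by simp [hw, ← hT]
  have hw0 : constantCoeff (constantCoeff w) = 0 := by rw [hwT]; simp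
  have hwq : w * (1 - w) * (1 - X) = T * (1 - T) := by
    have e : (1 - 2 * T) * y * (1 - X) = (1 - T) + X * T * y ^ 2 * (1 - X) := by
      linear_combination ((1 - 2 * T) * (1 - X)) * hy + ((1 - T) + X * T * y ^ 2 * (1 - X)) * h1
        + (C tau * (1 - T) * (1 - 2 * T)) * hz
    rw [hw]
    linear_combination T * X * e
  have hD1 : IsUnit (1 - T - w) := isUnit_of_constantCoeff_constantCoeff (by simp [hT0, hw0])
  have hN : IsUnit (1 - 2 * T - (1 - T) * w) :=
    isUnit_of_constantCoeff_constantCoeff (by simp [hT0, hw0])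
  have hT1 : IsUnit (1 - T) := isUnit_of_constantCoeff_constantCoeff (by simp [hT0])
  have hw1 : IsUnit (1 - w) := isUnit_of_constantCoeff_constantCoeff (by simp [hw0])
  have hT2 : IsUnit (1 - 2 * T) := isUnit_of_constantCoeff_constantCoeff (by simp [hT0])
  have hX0 : (C X : ℚ⟦X⟧⟦X⟧) ≠ 0 := by
    intro h
    have := congrArg constantCoeff h
    simp at this
  obtain ⟨i1, hi1⟩ := hD1.exists_left_inv
  obtain ⟨i2, hi2⟩ := (hT1.mul hN).exists_left_inv
  obtain ⟨p, hp⟩ : ∃ p, p = C tau * (1 + X * y) * (1 - 2 * T - (1 - T) * w) * i1 := ⟨_, rfl⟩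
  obtain ⟨k, hk⟩ :
    ∃ k, k = C tau * (1 + X * y) * (1 - 3 * T + T ^ 2 - (1 - 2 * T) * w) * i2 := ⟨_, rfl⟩
  have hp' : C X * p * (1 - T - w) = w * (1 - 2 * T - (1 - T) * w) := by
    rw [hp, hw, ← h2]
    rw [hw, ← h2] at hi1
    linear_combination (C X * (C tau * (1 + X * y) *
      (1 - 2 * (C X * C tau) - (1 - (C X * C tau)) * ((C X * C tau) * (1 + X * y))))) * hi1
  have hk' : C X * k * ((1 - T) * (1 - 2 * T - (1 - T) * w)) =
      w * (1 - 3 * T + T ^ 2 - (1 - 2 * T) * w) := by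
    rw [hk, hw, ← h2]
    rw [hw, ← h2] at hi2
    linear_combination (C X * (C tau * (1 + X * y) * (1 - 3 * (C X * C tau) + (C X * C tau) ^ 2 -
      (1 - 2 * (C X * C tau)) * ((C X * C tau) * (1 + X * y))))) * hi2
  have hcX : (X : ℚ⟦X⟧) ≠ 0 := X_ne_zero
  have hcT : constantCoeff T = param := by rw [← hT]; simp
  have hu : (1 - 2 * param : ℚ⟦X⟧) ≠ 0 := isUnit_one_sub_two_param.ne_zero
  have hp0 : constantCoeff p = series := by
    have h := congrArg constantCoeff hp'
    simp only [map_mul, map_sub, map_one, hcT, hwT, constantCoeff_C, map_ofNat] at h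
    apply mul_left_cancel₀ hcX
    apply mul_right_cancel₀ (pow_ne_zero 2 hu)
    have hs := series_mul
    have hx := X_eq
    linear_combination (1 - 2 * param) * h - X * hs - (1 - 3 * param + param ^ 2) * hx
  have hk0 : X * series * constantCoeff k = series - 1 := by
    have h := congrArg constantCoeff hk'
    simp only [map_mul, map_sub, map_add, map_pow, map_one, hcT, hwT, constantCoeff_C,
      map_ofNat] at h
    have hu1 : (1 - param : ℚ⟦X⟧) ≠ 0 := by
      intro h; have := congrArg constantCoeff h; simp at this
    apply mul_right_cancel₀ hu1
    apply mul_right_cancel₀ (pow_ne_zero 2 hu)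
    have hs := series_mul
    linear_combination (X * constantCoeff k * (1 - param) - (1 - param)) * hs + h
  refine ⟨p, k, hp0, ?_, ?_⟩
  -- Both identities become polynomial consequences of `hwq` once the denominators are cleared.
  · apply mul_left_cancel₀ hX0
    apply mul_right_cancel₀ hD1.ne_zero
    apply mul_right_cancel₀ (hT1.mul hN).ne_zero
    generalize (C X : ℚ⟦X⟧⟦X⟧) = x at *
    linear_combination ((1 - X) * ((1 - T) * (1 - 2 * T - (1 - T) * w))
      - (1 - X) * (x * k * ((1 - T) * (1 - 2 * T - (1 - T) * w)))) * hp'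
      - ((1 - X) * (w * (1 - 2 * T - (1 - T) * w))) * hk'
      + ((1 - 2 * T) * (1 - T - w) * (1 - 2 * T - (1 - T) * w)) * hwq
      - ((1 - T - w) * ((1 - T) * (1 - 2 * T - (1 - T) * w))) * h4
  · have hk0' : C X * C series * C (constantCoeff k) = (C series - 1 : ℚ⟦X⟧⟦X⟧) := by
      rw [← map_mul, ← map_mul, hk0, map_sub, map_one]
    generalize (C (constantCoeff k) : ℚ⟦X⟧⟦X⟧) = k0 at *
    apply mul_left_cancel₀ hX0
    apply mul_right_cancel₀ hD1.ne_zero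
    apply mul_right_cancel₀ (hT1.mul hN).ne_zero
    apply mul_right_cancel₀ hw1.ne_zero
    apply mul_right_cancel₀ (pow_ne_zero 2 hT2.ne_zero)
    have hF : C X * C series * (1 - 2 * T) = T * (1 - 3 * T + T ^ 2) := by
      apply mul_right_cancel₀ hT2.ne_zero
      linear_combination C X * h3 + (1 - 3 * T + T ^ 2) * h4
    have hF1 : (C X * (C series - 1)) * (1 - 2 * T) = T ^ 2 * (1 - 3 * T) := by
      linear_combination hF - (1 - 2 * T) * h4
    generalize (C X : ℚ⟦X⟧⟦X⟧) = x at *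
    generalize (C series : ℚ⟦X⟧⟦X⟧) = F at *
    linear_combination
      ((1 - w) * (1 - 2 * T) ^ 2 * (1 - T - w) * (X - x * F)) * hk'
      - ((1 - w) * (1 - 2 * T) ^ 2 * ((1 - T) * (1 - 2 * T - (1 - T) * w)) * X) * hp'
      + (x * ((1 - T - w) * ((1 - T) * (1 - 2 * T - (1 - T) * w)) * (1 - w) *
          (1 - 2 * T) ^ 2)) * hk0'
      - ((1 - w) * (1 - 2 * T) * (1 - T - w) * (w * (1 - 3 * T + T ^ 2 - (1 - 2 * T) * w))) * hF
      + ((1 - T - w) * ((1 - T) * (1 - 2 * T - (1 - T) * w)) * (1 - w) * (1 - 2 * T)) * hF1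
      - ((1 - 2 * T) ^ 2 * ((1 - 3 * T + T ^ 2 - (1 - 2 * T) * w) * (1 - T - w)
          - (1 - 2 * T - (1 - T) * w) * ((1 - T) * (1 - 2 * T - (1 - T) * w)))) * hwq

/-- The weights of chains of slots.  `P d` counts the ways to go on from a chain of `d` slots.  The
equation for `K` says that `K e` is the sum of `(X P 1) ^ h P (e + 1 + h)` over all `h`: a slot with
`e` smaller slots in its chain is chosen after `h` new components, each counted by `X P 1`, have
been appended, and their largest slots join the chain. -/
theorem exists_weights : ∃ P K : ℕ → ℚ⟦X⟧, P 1 = series ∧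
    (∀ e, K e = P (e + 1) + X * P 1 * K (e + 1)) ∧
    ∀ d, P d = 1 + X * ∑ e ∈ Finset.range d, K e * P (d - e) := by
  obtain ⟨p, k, hp0, hpk, hk⟩ := exists_weight_series
  have hP1 : coeff 0 p = series := by simpa using hp0
  refine ⟨fun d => if d = 0 then 1 else coeff (d - 1) p, fun e => coeff e k, by simpa using hp0,
    fun e => ?_, fun d => ?_⟩
  · have h := congrArg (coeff (e + 1)) hk
    rw [map_add, coeff_succ_X_mul, coeff_succ_X_mul, coeff_C_mul, map_sub, coeff_C] at h
    simpa [hP1] using h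
  · have h' : p = PowerSeries.mk 1 + C X * (k * p) := by
      have hX1 : IsUnit (1 - X : ℚ⟦X⟧⟦X⟧) := isUnit_of_constantCoeff_constantCoeff (by simp)
      apply mul_right_cancel₀ hX1.ne_zero
      have hz : (PowerSeries.mk 1 : ℚ⟦X⟧⟦X⟧) * (1 - X) = 1 :=
        PowerSeries.mk_one_mul_one_sub_eq_one _
      linear_combination hpk - hz
    cases d with
    | zero => simp
    | succ d =>
      have h := congrArg (coeff d) h'
      rw [map_add, coeff_mk, coeff_C_mul, coeff_mul,
        Finset.Nat.sum_antidiagonal_eq_sum_range_succ (fun i j => coeff i k * coeff j p)] at h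
      simp only [Nat.succ_ne_zero, if_false, Nat.add_sub_cancel, Pi.one_apply] at h ⊢
      rw [h]
      congr 2
      refine Finset.sum_congr rfl fun e he => ?_
      have he' := Finset.mem_range.1 he
      rw [if_neg (by omega), show d + 1 - e - 1 = d - e by omega]

end BicubicSeries

/-! ### States of the generating tree and their weights -/

/-- All ways to write a list as `l₁ ++ a :: l₂`, from left to right. -/
def List.splits {α : Type*} : List α → List (List α × α × List α)
  | [] => []
  | a :: l => ([], a, l) :: (splits l).map fun s => (a :: s.1, s.2.1, s.2.2)

theorem List.mem_splits {α : Type*} {l l₁ l₂ : List α} {a : α} :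
    (l₁, a, l₂) ∈ l.splits ↔ l = l₁ ++ a :: l₂ := by
  induction l generalizing l₁ with
  | nil => simp [List.splits]
  | cons b l ih =>
    cases l₁ with
    | nil => simp [List.splits, Prod.ext_iff, and_comm, eq_comm]
    | cons c l₁ =>
      have ih' := @ih l₁
      simp only [List.splits, List.mem_cons, List.mem_map, Prod.mk.injEq, Prod.exists]
      constructor
      · rintro (h | ⟨x, y, z, h, ⟨rfl, rfl⟩, rfl, rfl⟩)
        · simp at h
        · simpa using ih.1 h
      · intro h
        simp only [List.cons_append, List.cons.injEq] at h
        exact Or.inr ⟨l₁, a, l₂, ih.2 h.2, by rw [h.1], rfl, rfl⟩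

theorem List.sum_map_splits {α R : Type*} [AddCommMonoid R] (l : List α) (f : α → R) :
    (l.splits.map fun s => f s.2.1).sum = (l.map f).sum := by
  induction l with
  | nil => rfl
  | cons a l ih => simp [List.splits, Function.comp_def, ih]

theorem List.sum_map_splits_length {α R : Type*} [AddCommMonoid R] (l : List α)
    (f : ℕ → ℕ → R) :
    (l.splits.map fun s => f s.1.length s.2.2.length).sum =
      ∑ e ∈ Finset.range l.length, f e (l.length - 1 - e) := by
  induction l generalizing f with
  | nil => rfl
  | cons a l ih =>
    have h := ih fun e => f (e + 1)
    simp only [List.splits, List.map_cons, List.map_map, Function.comp_def, List.length_cons,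
      List.length_nil, List.sum_cons, Finset.sum_range_succ', h, Nat.add_sub_cancel, Nat.sub_zero]
    rw [add_comm]
    congr 1
    refine Finset.sum_congr rfl fun e he => ?_
    rw [Nat.sub_sub, Nat.add_comm 1 e]

/-- A state of the generating tree: the active slots of a permutation, grouped into chains, and the
chains grouped into blocks, one for each skew-indecomposable component.  Components are listed from
the last one (which has the smallest entries) to the first, slots from small to large. -/
abbrev SlotState (α : Type*) := List (List (List α))

namespace SlotState

variable {α β R : Type*} [CommRing R]

section Weights

variable (x : R) (P K : ℕ → R)

/-- The product of the weights of the chains of a block. -/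
def blockWeight (B : List (List α)) : R := (B.map fun c => P c.length).prod

/-- The weight of the continuations, up to the factor for the remaining blocks, in which the first
choice among the slots listed falls into the block `B`, when `j` blocks lie above it in the list. -/
def pickWeight (B : List (List α)) (j : ℕ) : R :=
  x * (B.splits.map fun y =>
    (y.2.1.splits.map fun z => K (z.1.length + j) * P (z.2.2.length + 1)).sum *
      blockWeight P y.2.2).sum

/-- The weight of the continuations that end in a state with a single block, for the state `S`
covered by `j` further blocks without chains. -/
def weight : SlotState α → ℕ → R
  | [], 0 => x * P 1
  | [], 1 => 1
  | [], _ + 2 => 0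
  | B :: S, j => weight S (j + 1) + weight S 1 * pickWeight x P K B j

variable {x P K}

/-- The pick weights of the chains of a block telescope. -/
theorem one_add_pickWeight (hP : ∀ d, P d = 1 + x * ∑ e ∈ Finset.range d, K e * P (d - e))
    (B : List (List α)) : 1 + pickWeight x P K B 0 = blockWeight P B := by
  induction B with
  | nil => simp [pickWeight, blockWeight, List.splits]
  | cons c B ih =>
    have hc : x * (c.splits.map fun z => K z.1.length * P (z.2.2.length + 1)).sum =
        P c.length - 1 := by
      rw [List.sum_map_splits_length c fun e f => K e * P (f + 1), hP c.length,
        add_sub_cancel_left]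
      congr 1
      refine Finset.sum_congr rfl fun e he => ?_
      have := Finset.mem_range.1 he
      rw [show c.length - 1 - e + 1 = c.length - e by omega]
    have h1 : blockWeight P (c :: B) = P c.length * blockWeight P B := by simp [blockWeight]
    have h2 : pickWeight x P K (c :: B) 0 =
        x * (c.splits.map fun z => K z.1.length * P (z.2.2.length + 1)).sum * blockWeight P B +
          pickWeight x P K B 0 := by
      simp [pickWeight, List.splits, Function.comp_def, mul_add, mul_assoc]
    rw [h1, h2, hc]
    linear_combination ih

theorem weight_cons_zero (hP : ∀ d, P d = 1 + x * ∑ e ∈ Finset.range d, K e * P (d - e))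
    (B : List (List α)) (S : SlotState α) :
    weight x P K (B :: S) 0 = blockWeight P B * weight x P K S 1 := by
  rw [weight, ← one_add_pickWeight hP B]; ring

/-- Choosing a slot `j` blocks down puts the largest slots of these blocks into its chain; the sum
over further blocks on top is absorbed by the recursion of `K`. -/
theorem pickWeight_sub (hK : ∀ e, K e = P (e + 1) + x * P 1 * K (e + 1)) (B : List (List α))
    (j : ℕ) : pickWeight x P K B j - x * P 1 * pickWeight x P K B (j + 1) =
      x * (B.splits.map fun y =>
        (y.2.1.splits.map fun z => P (z.1.length + j + 1) * P (z.2.2.length + 1)).sum *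
          blockWeight P y.2.2).sum := by
  have h : ∀ c : List α,
      (c.splits.map fun z => K (z.1.length + j) * P (z.2.2.length + 1)).sum =
        (c.splits.map fun z => P (z.1.length + j + 1) * P (z.2.2.length + 1)).sum + x * P 1 *
        (c.splits.map fun z => K (z.1.length + (j + 1)) * P (z.2.2.length + 1)).sum := by
    intro c
    rw [← List.sum_map_mul_left, ← List.sum_map_add]
    congr 2
    funext z
    rw [hK (z.1.length + j)]; ring_nf
  simp only [pickWeight, h, add_mul, List.sum_map_add]
  simp only [mul_assoc, List.sum_map_mul_left]
  ring

/-- The successor equation of `weight_eq` for a state covered by `j` further blocks. -/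
theorem weight_sub (hK : ∀ e, K e = P (e + 1) + x * P 1 * K (e + 1)) (S : SlotState α) (j : ℕ) :
    weight x P K S j - x * P 1 * weight x P K S (j + 1) =
      (if j + S.length = 1 then 1 else 0) + x * (S.splits.map fun Y =>
        (Y.2.1.splits.map fun y =>
          (y.2.1.splits.map fun z =>
            P (z.1.length + (j + Y.1.length) + 1) * P (z.2.2.length + 1)).sum *
          blockWeight P y.2.2).sum * weight x P K Y.2.2 1).sum := by
  induction S generalizing j with
  | nil =>
    rcases j with _ | _ | j <;> simp [weight, List.splits]
  | cons B S ih =>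
    have h := ih (j + 1)
    have h' := pickWeight_sub hK B j
    simp only [weight, List.splits, List.map_cons, List.map_map, Function.comp_def, List.sum_cons,
      List.length_cons, List.length_nil, add_zero]
    simp only [Nat.add_assoc, Nat.add_comm 1] at h h' ⊢
    linear_combination h + weight x P K S 1 * h'

theorem blockWeight_map (f : α → β) (B : List (List α)) :
    blockWeight P (B.map (List.map f)) = blockWeight P B := by
  simp [blockWeight, Function.comp_def]

end Weights

end SlotState

theorem List.splits_map {α β : Type*} (f : α → β) (l : List α) :
    (l.map f).splits = l.splits.map fun s => (s.1.map f, f s.2.1, s.2.2.map f) := by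
  induction l with
  | nil => rfl
  | cons a l ih => simp [List.splits, ih, Function.comp_def]

namespace SlotState

variable {α β R : Type*} [CommRing R] {x : R} {P K : ℕ → R}

theorem weight_map (f : α → β) (S : SlotState α) (j : ℕ) :
    weight x P K (S.map (List.map (List.map f))) j = weight x P K S j := by
  induction S generalizing j with
  | nil => rcases j with _ | _ | j <;> simp [weight]
  | cons B S ih =>
    have h : pickWeight x P K (B.map (List.map f)) j = pickWeight x P K B j := by
      simp [pickWeight, List.splits_map, Function.comp_def, blockWeight_map]
    simp only [List.map_cons, weight, ih, h]

/-- The largest slot of a block. -/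
def top (B : List (List ℕ)) : ℕ := B.flatten.getLastD 0

/-- Raises all slots by one. -/
def shift (S : SlotState ℕ) : SlotState ℕ := S.map (List.map (List.map Nat.succ))

/-- The state after appending the smallest entry: a new component begins. -/
def push (S : SlotState ℕ) : SlotState ℕ := [[1]] :: shift S

/-- The state after appending an entry in the slot `v` that stands between `c₁` and `c₂` in its
chain, in front of the chains `b₂` of its block, with the blocks `A` above and `C` below in the
list.  The slot `v` splits into `v` and `v + 1`; of the smaller slots those in `A.map top ++ c₁`
stay active. -/
def pick (A : SlotState ℕ) (C : SlotState ℕ) (b₂ : List (List ℕ)) (c₁ : List ℕ) (v : ℕ)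
    (c₂ : List ℕ) : SlotState ℕ :=
  ((A.map top ++ c₁ ++ [v]) :: (v :: c₂).map Nat.succ :: b₂.map (List.map Nat.succ)) :: shift C

/-- The total weight of a state is the sum of the weights of its successors, each multiplied by `x`,
plus one if the state has a single block. -/
theorem weight_eq (hK : ∀ e, K e = P (e + 1) + x * P 1 * K (e + 1))
    (hP : ∀ d, P d = 1 + x * ∑ e ∈ Finset.range d, K e * P (d - e)) (S : SlotState ℕ) :
    weight x P K S 0 = (if S.length = 1 then 1 else 0) + x * (weight x P K (push S) 0 +
      (S.splits.map fun Y => (Y.2.1.splits.map fun y => (y.2.1.splits.map fun z =>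
        weight x P K (pick Y.1 Y.2.2 y.2.2 z.1 z.2.1 z.2.2) 0).sum).sum).sum) := by
  have h1 : weight x P K (push S) 0 = P 1 * weight x P K S 1 := by
    rw [push, weight_cons_zero hP, shift, weight_map]; simp [blockWeight]
  have h2 : ∀ A C b₂ c₁ v c₂, weight x P K (pick A C b₂ c₁ v c₂) 0 =
      P (c₁.length + A.length + 1) * P (c₂.length + 1) * blockWeight P b₂ * weight x P K C 1 := by
    intro A C b₂ c₁ v c₂
    rw [pick, weight_cons_zero hP, shift, weight_map]
    have : blockWeight P ((A.map top ++ c₁ ++ [v]) :: (v :: c₂).map Nat.succ ::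
        b₂.map (List.map Nat.succ)) = P (c₁.length + A.length + 1) * P (c₂.length + 1) *
          blockWeight P (b₂.map (List.map Nat.succ)) := by
      rw [show c₁.length + A.length + 1 = A.length + (c₁.length + 1) by ring]
      simp [blockWeight, mul_assoc]
    rw [this, blockWeight_map]
  have h := weight_sub hK S 0
  simp only [zero_add] at h
  simp only [h1, h2, List.sum_map_mul_right]
  linear_combination h

end SlotState

/-! ### Appending a last entry to a permutation -/

section Append

variable {m : ℕ}

/-- The permutation of length `m + 1` that ends with `v` and whose other entries are ordered like
those of `p`. -/
def appendLast (v : Fin (m + 1)) (p : Equiv.Perm (Fin m)) : Equiv.Perm (Fin (m + 1)) :=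
  (finSuccEquiv' (Fin.last m)).trans (p.optionCongr.trans (finSuccEquiv' v).symm)

@[simp] theorem appendLast_last (v : Fin (m + 1)) (p : Equiv.Perm (Fin m)) :
    appendLast v p (Fin.last m) = v := by
  simp [appendLast]

@[simp] theorem appendLast_castSucc (v : Fin (m + 1)) (p : Equiv.Perm (Fin m)) (i : Fin m) :
    appendLast v p i.castSucc = v.succAbove (p i) := by
  have h : finSuccEquiv' (Fin.last m) i.castSucc = some i :=
    finSuccEquiv'_below (Fin.castSucc_lt_last i)
  simp [appendLast, h]

theorem val_appendLast_castSucc (v : Fin (m + 1)) (p : Equiv.Perm (Fin m)) (i : Fin m) :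
    (appendLast v p i.castSucc : ℕ) = if (p i : ℕ) < v then (p i : ℕ) else p i + 1 := by
  rw [appendLast_castSucc, Fin.succAbove]
  simp only [Fin.lt_def, Fin.val_castSucc]
  split_ifs <;> simp

theorem appendLast_bijective :
    Function.Bijective fun x : Fin (m + 1) × Equiv.Perm (Fin m) => appendLast x.1 x.2 := by
  rw [Fintype.bijective_iff_injective_and_card]
  constructor
  · rintro ⟨v, p⟩ ⟨w, q⟩ h
    simp only at h
    have hv : v = w := by
      have := congrArg (fun r => r (Fin.last m)) h
      simpa using this
    subst hv
    have hp : p = q := by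
      ext i
      have := congrArg (fun r => r i.castSucc) h
      simp only [appendLast_castSucc] at this
      rw [Fin.succAbove_right_injective this]
    rw [hp]
  · simp [Fintype.card_perm, Nat.factorial_succ]

/-- `p` has no `1342` pattern. -/
def Avoids1342 (p : Equiv.Perm (Fin m)) : Prop :=
  ∀ a b c d : Fin m, a < b → b < c → c < d → ¬ (p a < p d ∧ p d < p b ∧ p b < p c)

/-- The slot `s` of `p`, which lies between the values `s - 1` and `s`, is active: an entry appended
there is not the last entry of a `1342` pattern. -/
def ActiveSlot (p : Equiv.Perm (Fin m)) (s : ℕ) : Prop :=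
  s ≤ m ∧ ∀ i j k : Fin m, i < j → j < k → ¬ ((p i : ℕ) < s ∧ s ≤ p j ∧ p j < p k)

/-- All values in `[t, s)` stand to the left of all values below `t`. -/
def SlotCut (p : Equiv.Perm (Fin m)) (t s : ℕ) : Prop :=
  ∀ i j : Fin m, (p j : ℕ) < t → t ≤ p i → (p i : ℕ) < s → i < j

theorem slotCut_zero (p : Equiv.Perm (Fin m)) (s : ℕ) : SlotCut p 0 s :=
  fun _ _ h => absurd h (Nat.not_lt_zero _)

theorem slotCut_self (p : Equiv.Perm (Fin m)) (s : ℕ) : SlotCut p s s :=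
  fun _ _ _ h h' => absurd h' (Nat.not_lt.2 h)

theorem slotCut_iff_of_slotCut {p : Equiv.Perm (Fin m)} {t u s : ℕ} (htu : t ≤ u) (hus : u ≤ s)
    (h : SlotCut p u s) : SlotCut p t s ↔ SlotCut p t u := by
  constructor
  · exact fun h' i j h1 h2 h3 => h' i j h1 h2 (h3.trans_le hus)
  · intro h' i j h1 h2 h3
    rcases lt_or_ge (p i : ℕ) u with h4 | h4
    · exact h' i j h1 h2 h4
    · exact h i j (h1.trans_le htu) h4 h3

theorem activeSlot_zero (p : Equiv.Perm (Fin m)) : ActiveSlot p 0 :=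
  ⟨Nat.zero_le _, fun _ _ _ _ _ h => absurd h.1 (Nat.not_lt_zero _)⟩

theorem activeSlot_top (p : Equiv.Perm (Fin m)) : ActiveSlot p m :=
  ⟨le_rfl, fun _ j _ _ _ h => absurd (p j).isLt (Nat.not_lt.2 h.2.1)⟩

/-- The last entry can only play the entry `2` of a new pattern. -/
theorem avoids1342_appendLast {p : Equiv.Perm (Fin m)} {v : Fin (m + 1)} :
    Avoids1342 (appendLast v p) ↔ Avoids1342 p ∧ ActiveSlot p v := by
  constructor
  · intro h
    refine ⟨fun a b c d hab hbc hcd h' => ?_, Nat.lt_succ_iff.1 v.isLt, fun i j k hij hjk h' => ?_⟩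
    · refine h a.castSucc b.castSucc c.castSucc d.castSucc hab hbc hcd ?_
      simp only [Fin.lt_def, val_appendLast_castSucc] at h' ⊢
      split_ifs <;> omega
    · refine h i.castSucc j.castSucc k.castSucc (Fin.last m) hij hjk (Fin.castSucc_lt_last k) ?_
      simp only [Fin.lt_def, val_appendLast_castSucc, appendLast_last] at h' ⊢
      split_ifs <;> omega
  · rintro ⟨h, -, hv⟩ a b c d hab hbc hcd h'
    obtain ⟨c, rfl⟩ := Fin.exists_castSucc_eq.2 (ne_of_lt (hcd.trans_le (Fin.le_last d)))
    obtain ⟨b, rfl⟩ := Fin.exists_castSucc_eq.2 (ne_of_lt (hbc.trans_le (Fin.le_last _)))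
    obtain ⟨a, rfl⟩ := Fin.exists_castSucc_eq.2 (ne_of_lt (hab.trans_le (Fin.le_last _)))
    induction d using Fin.lastCases with
    | last =>
      refine hv a b c hab hbc ?_
      simp only [Fin.lt_def, val_appendLast_castSucc, appendLast_last] at h' ⊢
      split_ifs at h' <;> omega
    | cast d =>
      refine h a b c d hab hbc hcd ?_
      simp only [Fin.lt_def, val_appendLast_castSucc] at h' ⊢
      split_ifs at h' <;> omega

/-- Below the new entry `v` exactly those slots stay active at which the values below `v` are
cut. -/
theorem activeSlot_appendLast_of_le {p : Equiv.Perm (Fin m)} {v : Fin (m + 1)}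
    (hv : ActiveSlot p v) {s : ℕ} (hs : s ≤ v) :
    ActiveSlot (appendLast v p) s ↔ SlotCut p s v := by
  constructor
  · rintro ⟨-, h⟩ i j h1 h2 h3
    by_contra hij
    have hne : j ≠ i := by rintro rfl; omega
    refine h j.castSucc i.castSucc (Fin.last m)
      (show j < i from lt_of_le_of_ne (not_lt.1 hij) hne) (Fin.castSucc_lt_last i) ?_
    simp only [Fin.lt_def, val_appendLast_castSucc, appendLast_last]
    split_ifs <;> omega
  · intro h
    refine ⟨by omega, fun i j k hij hjk h' => ?_⟩
    obtain ⟨j, rfl⟩ := Fin.exists_castSucc_eq.2 (ne_of_lt (hjk.trans_le (Fin.le_last k)))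
    obtain ⟨i, rfl⟩ := Fin.exists_castSucc_eq.2 (ne_of_lt (hij.trans_le (Fin.le_last _)))
    have hij' : i < j := hij
    by_cases hj : (p j : ℕ) < v
    · have h1 : (p i : ℕ) < s ∧ s ≤ p j := by
        simp only [Fin.lt_def, val_appendLast_castSucc] at h'
        split_ifs at h' <;> omega
      exact absurd (h j i h1.1 h1.2 hj) (not_lt.2 hij'.le)
    · induction k using Fin.lastCases with
      | last =>
        simp only [Fin.lt_def, val_appendLast_castSucc, appendLast_last] at h'
        split_ifs at h' <;> omega
      | cast k =>
        refine hv.2 i j k hij hjk ?_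
        simp only [Fin.lt_def, val_appendLast_castSucc] at h' ⊢
        split_ifs at h' <;> omega

theorem activeSlot_appendLast_of_gt {p : Equiv.Perm (Fin m)} {v : Fin (m + 1)} {s : ℕ}
    (hs : v < s) : ActiveSlot (appendLast v p) s ↔ ActiveSlot p (s - 1) := by
  constructor
  · rintro ⟨h1, h⟩
    refine ⟨by omega, fun i j k hij hjk h' => ?_⟩
    refine h i.castSucc j.castSucc k.castSucc hij hjk ?_
    simp only [Fin.lt_def, val_appendLast_castSucc] at h' ⊢
    split_ifs <;> omega
  · rintro ⟨h1, h⟩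
    refine ⟨by omega, fun i j k hij hjk h' => ?_⟩
    obtain ⟨j, rfl⟩ := Fin.exists_castSucc_eq.2 (ne_of_lt (hjk.trans_le (Fin.le_last k)))
    obtain ⟨i, rfl⟩ := Fin.exists_castSucc_eq.2 (ne_of_lt (hij.trans_le (Fin.le_last _)))
    induction k using Fin.lastCases with
    | last =>
      simp only [Fin.lt_def, val_appendLast_castSucc, appendLast_last] at h'
      split_ifs at h' <;> omega
    | cast k =>
      refine h i j k hij hjk ?_
      simp only [Fin.lt_def, val_appendLast_castSucc] at h' ⊢
      split_ifs at h' <;> omega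

theorem slotCut_appendLast_of_le {p : Equiv.Perm (Fin m)} {v : Fin (m + 1)} {t s : ℕ}
    (hs : s ≤ v) (hts : t ≤ s) : SlotCut (appendLast v p) t s ↔ SlotCut p t s := by
  constructor
  · intro h i j h1 h2 h3
    refine Fin.castSucc_lt_castSucc_iff.1 (h i.castSucc j.castSucc ?_ ?_ ?_) <;>
    · rw [val_appendLast_castSucc]
      split_ifs <;> omega
  · intro h i j h1 h2 h3
    induction i using Fin.lastCases with
    | last => rw [appendLast_last] at h3; omega
    | cast i =>
      induction j using Fin.lastCases with
      | last => exact Fin.castSucc_lt_last i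
      | cast j =>
        rw [val_appendLast_castSucc] at h1 h2 h3
        refine Fin.castSucc_lt_castSucc_iff.2 (h i j ?_ ?_ ?_) <;> split_ifs at h1 h2 h3 <;> omega

theorem slotCut_appendLast_of_gt {p : Equiv.Perm (Fin m)} {v : Fin (m + 1)} {t s : ℕ}
    (hs : v < s) (ht : 0 < t) (hts : t ≤ s) :
    SlotCut (appendLast v p) t s ↔ v < t ∧ SlotCut p (t - 1) (s - 1) := by
  constructor
  · intro h
    have hvt : v < t := by
      by_contra hvt
      -- The value `0` would stand to the right of the last entry.
      have h0 := h (Fin.last m) ((appendLast v p).symm ⟨0, by omega⟩) (by simpa using ht)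
        (by rw [appendLast_last]; omega) (by rw [appendLast_last]; exact hs)
      exact absurd h0 (not_lt.2 (Fin.le_last _))
    refine ⟨hvt, fun i j h1 h2 h3 => ?_⟩
    refine Fin.castSucc_lt_castSucc_iff.1 (h i.castSucc j.castSucc ?_ ?_ ?_) <;>
    · rw [val_appendLast_castSucc]
      split_ifs <;> omega
  · rintro ⟨hvt, h⟩ i j h1 h2 h3
    induction i using Fin.lastCases with
    | last => rw [appendLast_last] at h2; omega
    | cast i =>
      induction j using Fin.lastCases with
      | last => exact Fin.castSucc_lt_last i
      | cast j =>
        rw [val_appendLast_castSucc] at h1 h2 h3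
        refine Fin.castSucc_lt_castSucc_iff.2 (h i j ?_ ?_ ?_) <;> split_ifs at h1 h2 h3 <;> omega

end Append

/-! ### Decomposability and pattern avoidance in terms of slots -/

section Indecomposable

variable {m : ℕ}

/-- If the first `c` entries exceed all others, they are the `c` largest ones. -/
theorem lt_iff_of_forall_lt {σ : Equiv.Perm (Fin m)} {c : ℕ} (hc : c ≤ m)
    (h : ∀ i j : Fin m, (i : ℕ) < c → c ≤ (j : ℕ) → σ j < σ i) (i : Fin m) :
    (i : ℕ) < c ↔ m - c ≤ σ i := by
  constructor
  · intro hi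
    have h1 : ((Finset.univ.filter fun j : Fin m => c ≤ (j : ℕ)).map σ.toEmbedding) ⊆
        Finset.Iio (σ i) := by
      intro y hy
      obtain ⟨j, hj, rfl⟩ := Finset.mem_map.1 hy
      exact Finset.mem_Iio.2 (h i j hi (Finset.mem_filter.1 hj).2)
    have h2 := Finset.card_le_card h1
    have h3 : (Finset.univ.filter fun j : Fin m => c ≤ (j : ℕ)).card +
        (Finset.univ.filter fun j : Fin m => ¬ c ≤ (j : ℕ)).card = m := by
      rw [Finset.card_filter_add_card_filter_not]; simp
    have h4 : (Finset.univ.filter fun j : Fin m => ¬ c ≤ (j : ℕ)).card ≤ c := by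
      simp only [not_le, Fin.card_filter_val_lt]; omega
    rw [Finset.card_map, Fin.card_Iio] at h2
    omega
  · intro hi
    by_contra hic
    have h1 : ((Finset.univ.filter fun j : Fin m => (j : ℕ) < c).map σ.toEmbedding) ⊆
        Finset.Ioi (σ i) := by
      intro y hy
      obtain ⟨j, hj, rfl⟩ := Finset.mem_map.1 hy
      exact Finset.mem_Ioi.2 (h j i (Finset.mem_filter.1 hj).2 (not_lt.1 hic))
    have h2 := Finset.card_le_card h1
    rw [Finset.card_map, Fin.card_Ioi, Fin.card_filter_val_lt] at h2
    have := (σ i).isLt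
    omega

/-- A cut between positions is the same as a cut between values: apply `lt_iff_of_forall_lt` to the
permutation and to its inverse. -/
theorem isIndecomposable_iff_slotCut {p : Equiv.Perm (Fin m)} :
    IsIndecomposable p ↔ ¬ ∃ t, 0 < t ∧ t < m ∧ SlotCut p t m := by
  refine not_congr ⟨?_, ?_⟩
  · rintro ⟨c, hc0, hcm, h⟩
    have key := lt_iff_of_forall_lt hcm.le h
    refine ⟨m - c, by omega, by omega, fun i j hj hi _ => ?_⟩
    have h1 := (key i).2 hi
    have h2 : ¬ (j : ℕ) < c := fun hjc => by have := (key j).1 hjc; omega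
    rw [Fin.lt_def]; omega
  · rintro ⟨t, ht0, htm, h⟩
    have key := lt_iff_of_forall_lt (σ := p.symm) htm.le fun i j hi hj =>
      h (p.symm j) (p.symm i) (by simpa using hi) (by simpa using hj) (by simp)
    refine ⟨m - t, by omega, by omega, fun i j hi hj => ?_⟩
    have h1 := key (p i)
    have h2 := key (p j)
    rw [Equiv.symm_apply_apply] at h1 h2
    rw [Fin.lt_def]; omega

theorem avoidsPattern_iff {p : Equiv.Perm (Fin m)} :
    AvoidsPattern pattern1342 p ↔ Avoids1342 p := by
  constructor
  · intro h a b c d hab hbc hcd ⟨h1, h2, h3⟩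
    refine h ⟨![a, b, c, d], ?_, ?_⟩
    · rw [Fin.strictMono_iff_lt_succ]
      intro i
      fin_cases i <;> assumption
    · have h4 := h1.trans h2
      have h5 := h2.trans h3
      have h6 := h1.trans h5
      intro i j
      fin_cases i <;> fin_cases j <;>
        simp [pattern1342, h1, h2, h3, h4, h5, h6, h1.le, h2.le, h3.le, h4.le, h5.le, h6.le]
  · rintro h ⟨f, hf, hp⟩
    refine h (f 0) (f 1) (f 2) (f 3) (hf (by decide)) (hf (by decide)) (hf (by decide))
      ⟨(hp 0 3).2 (by decide), (hp 3 1).2 (by decide), (hp 1 2).2 (by decide)⟩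

end Indecomposable

/-! ### The state of a permutation -/

namespace SlotState

/-- The entries of the table of a chain: each slot with the list of the smaller slots of the chain,
preceded by `l`. -/
def chainTable (l : List ℕ) : List ℕ → List (ℕ × List ℕ)
  | [] => []
  | v :: c => (v, l) :: chainTable (l ++ [v]) c

/-- The table of a state: each slot with the list of the slots at which the values below it are cut,
preceded by `l`.  These are the largest slots of the earlier blocks in the list and the smaller
slots of the same chain. -/
def table (l : List ℕ) : SlotState ℕ → List (ℕ × List ℕ)
  | [] => []
  | B :: S => B.flatMap (chainTable l) ++ table (l ++ [top B]) S

theorem chainTable_append (l c d : List ℕ) :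
    chainTable l (c ++ d) = chainTable l c ++ chainTable (l ++ c) d := by
  induction c generalizing l with
  | nil => simp [chainTable]
  | cons a c ih => simp [chainTable, ih]

theorem table_append (l : List ℕ) (A C : SlotState ℕ) :
    table l (A ++ C) = table l A ++ table (l ++ A.map top) C := by
  induction A generalizing l with
  | nil => simp [table]
  | cons B A ih => simp [table, ih]

theorem chainTable_append_left (l l' c : List ℕ) :
    chainTable (l ++ l') c = (chainTable l' c).map fun e => (e.1, l ++ e.2) := by
  induction c generalizing l' with
  | nil => rfl
  | cons a c ih => simp [chainTable, ← ih]

theorem table_append_left (l l' : List ℕ) (S : SlotState ℕ) :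
    table (l ++ l') S = (table l' S).map fun e => (e.1, l ++ e.2) := by
  induction S generalizing l' with
  | nil => rfl
  | cons B S ih =>
    simp only [table, List.map_append, ← ih, List.append_assoc, List.map_flatMap]
    congr 2
    funext c
    exact chainTable_append_left l l' c

theorem chainTable_map (f : ℕ → ℕ) (l c : List ℕ) :
    chainTable (l.map f) (c.map f) = (chainTable l c).map fun e => (f e.1, e.2.map f) := by
  induction c generalizing l with
  | nil => rfl
  | cons a c ih => simp [chainTable, ← ih]

theorem succ_mem_map_succ {s : ℕ} {l : List ℕ} : s + 1 ∈ l.map Nat.succ ↔ s ∈ l :=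
  List.mem_map_of_injective Nat.succ_injective

theorem top_map {B : List (List ℕ)} (hB : B.flatten ≠ []) :
    top (B.map (List.map Nat.succ)) = (top B).succ := by
  rw [top, top, ← List.map_flatten, List.getLastD_eq_getLast?, List.getLastD_eq_getLast?,
    List.getLast?_map, List.getLast?_eq_some_getLast hB]
  rfl

theorem table_shift (l : List ℕ) {S : SlotState ℕ} (hS : ∀ B ∈ S, B.flatten ≠ []) :
    table (l.map Nat.succ) (shift S) =
      (table l S).map fun e => (e.1 + 1, e.2.map Nat.succ) := by
  induction S generalizing l with
  | nil => rfl
  | cons B S ih =>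
    have h1 := ih (l ++ [top B]) fun B' hB' => hS B' (List.mem_cons_of_mem _ hB')
    have h2 := top_map (hS B List.mem_cons_self)
    simp only [shift, List.map_cons, table, h2, List.map_append, List.map_nil,
      List.map_flatMap, List.flatMap_map] at h1 ⊢
    rw [h1]
    congr 2
    funext c
    exact chainTable_map Nat.succ l c

theorem mem_chainTable {l c k : List ℕ} {s : ℕ} :
    (s, k) ∈ chainTable l c ↔ ∃ c₁ c₂, c = c₁ ++ s :: c₂ ∧ k = l ++ c₁ := by
  induction c generalizing l with
  | nil => simp [chainTable]
  | cons a c ih =>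
    simp only [chainTable, List.mem_cons, Prod.mk.injEq, ih]
    constructor
    · rintro (⟨rfl, rfl⟩ | ⟨c₁, c₂, rfl, rfl⟩)
      · exact ⟨[], c, rfl, by simp⟩
      · exact ⟨a :: c₁, c₂, by simp, by simp⟩
    · rintro ⟨_ | ⟨b, c₁⟩, c₂, h, rfl⟩
      · simp only [List.nil_append, List.cons.injEq] at h
        exact Or.inl ⟨h.1.symm, by simp⟩
      · simp only [List.cons_append, List.cons.injEq] at h
        exact Or.inr ⟨c₁, c₂, h.2, by simp [h.1]⟩

theorem top_mem {B : List (List ℕ)} (hB : B.flatten ≠ []) : top B ∈ B.flatten := by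
  rw [top, List.getLastD_eq_getLast?, List.getLast?_eq_some_getLast hB]
  exact List.getLast_mem hB

theorem mem_of_mem_table {l k : List ℕ} {s : ℕ} {S : SlotState ℕ}
    (hS : ∀ B ∈ S, B.flatten ≠ []) (h : (s, k) ∈ table l S) :
    s ∈ S.flatten.flatten ∧ ∀ t ∈ k, t ∈ l ∨ t ∈ S.flatten.flatten := by
  induction S generalizing l with
  | nil => simp [table] at h
  | cons B S ih =>
    have hB := hS B List.mem_cons_self
    rw [table, List.mem_append] at h
    simp only [List.flatten_cons, List.flatten_append, List.mem_append]
    rcases h with h | h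
    · obtain ⟨c, hc, h⟩ := List.mem_flatMap.1 h
      obtain ⟨c₁, c₂, rfl, rfl⟩ := mem_chainTable.1 h
      refine ⟨Or.inl (List.mem_flatten.2 ⟨_, hc, by simp⟩), fun t ht => ?_⟩
      rcases List.mem_append.1 ht with ht | ht
      · exact Or.inl ht
      · exact Or.inr (Or.inl (List.mem_flatten.2 ⟨_, hc, by simp [ht]⟩))
    · obtain ⟨h1, h2⟩ := ih (fun B' hB' => hS B' (List.mem_cons_of_mem _ hB')) h
      refine ⟨Or.inr h1, fun t ht => ?_⟩
      rcases h2 t ht with h3 | h3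
      · rcases List.mem_append.1 h3 with h4 | h4
        · exact Or.inl h4
        · rw [List.mem_singleton.1 h4]
          exact Or.inr (Or.inl (top_mem hB))
      · exact Or.inr (Or.inr h3)

theorem map_top_sublist {A : SlotState ℕ} (hA : ∀ B ∈ A, B.flatten ≠ []) :
    (A.map top).Sublist A.flatten.flatten := by
  induction A with
  | nil => simp
  | cons B A ih =>
    have h1 : [top B].Sublist B.flatten :=
      List.singleton_sublist.2 (top_mem (hA B List.mem_cons_self))
    simpa using h1.append (ih fun B' hB' => hA B' (List.mem_cons_of_mem _ hB'))

/-- The state `S` describes the active slots of the permutation `p`, which avoids `1342`: its slots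
are `0` and the active ones, `0` being left out of the list, and its table records the cuts.  Every
block ends with a chain of a single slot. -/
structure IsStateOf {m : ℕ} (S : SlotState ℕ) (p : Equiv.Perm (Fin m)) : Prop where
  avoids : Avoids1342 p
  sorted : S.flatten.flatten.Pairwise (· < ·)
  active : ∀ s, ActiveSlot p s ↔ s = 0 ∨ s ∈ S.flatten.flatten
  pos : ∀ s ∈ S.flatten.flatten, 0 < s
  cut : ∀ s k, (s, k) ∈ table [] S → ∀ t, t ∈ k ↔ 0 < t ∧ t < s ∧ SlotCut p t s
  blocks : ∀ B ∈ S, ∃ b t, B = b ++ [[t]]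

variable {m : ℕ} {p : Equiv.Perm (Fin m)} {S : SlotState ℕ}

theorem IsStateOf.flatten_ne_nil (h : S.IsStateOf p) : ∀ B ∈ S, B.flatten ≠ [] := by
  intro B hB
  obtain ⟨b, t, rfl⟩ := h.blocks B hB
  simp

theorem isStateOf_nil (p : Equiv.Perm (Fin 0)) : IsStateOf [] p where
  avoids a := a.elim0
  sorted := by simp
  active s := by
    constructor
    · rintro ⟨h, -⟩; exact Or.inl (by omega)
    · rintro (rfl | h)
      · exact activeSlot_zero p
      · simp at h
  pos := by simp
  cut := by simp [table]
  blocks := by simp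

theorem blocks_shift {C : SlotState ℕ} (h : ∀ B ∈ C, ∃ b t, B = b ++ [[t]]) :
    ∀ B ∈ shift C, ∃ b t, B = b ++ [[t]] := by
  intro B hB
  obtain ⟨B', hB', rfl⟩ := List.mem_map.1 hB
  obtain ⟨b, t, rfl⟩ := h B' hB'
  exact ⟨b.map (List.map Nat.succ), t + 1, by simp⟩

theorem flatten_shift (C : SlotState ℕ) :
    (shift C).flatten.flatten = C.flatten.flatten.map Nat.succ := by
  simp [shift, List.map_flatten]

/-- Appending the smallest entry starts a new component. -/
theorem IsStateOf.push (h : S.IsStateOf p) : IsStateOf (push S) (appendLast 0 p) := by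
  have hflat : (SlotState.push S).flatten.flatten = 1 :: S.flatten.flatten.map Nat.succ := by
    rw [SlotState.push, ← flatten_shift]; simp
  constructor
  · exact avoids1342_appendLast.2 ⟨h.avoids, activeSlot_zero p⟩
  · rw [hflat, List.pairwise_cons, List.pairwise_map]
    refine ⟨fun s hs => ?_, h.sorted.imp fun hab => Nat.succ_lt_succ hab⟩
    obtain ⟨t, ht, rfl⟩ := List.mem_map.1 hs
    exact Nat.succ_lt_succ (h.pos t ht)
  · intro s
    rw [hflat]
    rcases Nat.eq_zero_or_pos s with rfl | hs
    · simp [activeSlot_zero]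
    · rw [activeSlot_appendLast_of_gt (by simpa using hs), h.active]
      obtain ⟨s, rfl⟩ : ∃ s', s = s' + 1 := ⟨s - 1, by omega⟩
      rw [List.mem_cons, succ_mem_map_succ, Nat.add_sub_cancel]
      simp
  · intro s hs
    rw [hflat] at hs
    rcases List.mem_cons.1 hs with rfl | hs
    · exact Nat.one_pos
    · obtain ⟨t, ht, rfl⟩ := List.mem_map.1 hs
      exact Nat.succ_pos t
  · intro s k hsk t
    have htab : table [] (SlotState.push S) = (1, []) ::
        (table [] S).map fun e => (e.1 + 1, ([0] ++ e.2).map Nat.succ) := by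
      have h1 := table_shift [0] h.flatten_ne_nil
      have h2 := table_append_left [0] [] S
      rw [List.append_nil] at h2
      rw [h2, List.map_map] at h1
      rw [SlotState.push, table]
      exact congrArg ((1, []) :: ·) h1
    rw [htab] at hsk
    rcases List.mem_cons.1 hsk with hsk | hsk
    · obtain ⟨rfl, rfl⟩ := Prod.mk.inj hsk
      simp only [List.not_mem_nil, false_iff]
      omega
    · obtain ⟨⟨s', k'⟩, he, hsk⟩ := List.mem_map.1 hsk
      obtain ⟨rfl, rfl⟩ := Prod.mk.inj hsk
      have hs' := h.pos s' (mem_of_mem_table h.flatten_ne_nil he).1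
      have hk := h.cut s' k' he
      rcases Nat.eq_zero_or_pos t with rfl | ht
      · simp
      · obtain ⟨t, rfl⟩ : ∃ t', t = t' + 1 := ⟨t - 1, by omega⟩
        have hmem : t + 1 ∈ ([0] ++ k').map Nat.succ ↔ t = 0 ∨ t ∈ k' := by simp
        rw [hmem, hk]
        by_cases hts : t < s'
        · rw [slotCut_appendLast_of_gt (by simp) ht (by omega)]
          simp only [Nat.add_sub_cancel, Fin.val_zero, ht, true_and, hts, Nat.succ_lt_succ_iff]
          rcases Nat.eq_zero_or_pos t with rfl | ht0
          · simp [slotCut_zero]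
          · simp [ht0, ht0.ne']
        · constructor
          · rintro (rfl | ⟨-, h2, -⟩) <;> omega
          · rintro ⟨-, h2, -⟩; omega
  · intro B hB
    rcases List.mem_cons.1 hB with rfl | hB
    · exact ⟨[], 1, rfl⟩
    · exact blocks_shift h.blocks B hB

/-- Appending an entry in an active slot `v > 0` changes the state as described at
`SlotState.pick`. -/
theorem IsStateOf.pick {A C : SlotState ℕ} {b₁ b₂ : List (List ℕ)} {c₁ c₂ : List ℕ}
    {v : Fin (m + 1)} (h : S.IsStateOf p)
    (hS : S = A ++ (b₁ ++ (c₁ ++ (v : ℕ) :: c₂) :: b₂) :: C) :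
    IsStateOf (pick A C b₂ c₁ v c₂) (appendLast v p) := by
  obtain ⟨w, hw⟩ : ∃ w : ℕ, w = v := ⟨_, rfl⟩
  rw [← hw] at hS ⊢
  have hne := h.flatten_ne_nil
  have hneA : ∀ B ∈ A, B.flatten ≠ [] := fun B hB => hne B (by simp [hS, hB])
  have hneC : ∀ B ∈ C, B.flatten ≠ [] := fun B hB => hne B (by simp [hS, hB])
  obtain ⟨l, hl⟩ : ∃ l, l = A.map top ++ c₁ := ⟨_, rfl⟩
  obtain ⟨R, hR⟩ : ∃ R, R = c₂ ++ b₂.flatten ++ C.flatten.flatten := ⟨_, rfl⟩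
  obtain ⟨Q, hQ⟩ : ∃ Q, Q = A.flatten.flatten ++ b₁.flatten ++ c₁ := ⟨_, rfl⟩
  have hF : S.flatten.flatten = Q ++ w :: R := by simp [hS, hQ, hR]
  have hlQ : l.Sublist Q := by
    rw [hl, hQ, List.append_assoc]
    exact (map_top_sublist hneA).append (List.sublist_append_right _ _)
  have hsorted := h.sorted
  rw [hF, List.pairwise_append] at hsorted
  obtain ⟨hQs, hRs, hQR⟩ := hsorted
  have hQw : ∀ t ∈ Q, t < w := fun t ht => hQR t ht w List.mem_cons_self
  have hlw : ∀ t ∈ l, t < w := fun t ht => hQw t (hlQ.subset ht)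
  have hRw : ∀ t ∈ w :: R, w ≤ t := by
    intro t ht
    rcases List.mem_cons.1 ht with rfl | ht
    · exact le_rfl
    · exact ((List.pairwise_cons.1 hRs).1 t ht).le
  have hwpos : 0 < w := h.pos w (by simp [hF])
  have hactive : ActiveSlot p v := by rw [← hw, h.active, hF]; simp
  -- The table of `S` contains the parts that survive.
  have htab : table [] S = table [] A ++ ((b₁.flatMap (chainTable (A.map top)) ++
      ((chainTable (A.map top) c₁ ++ chainTable l (w :: c₂)) ++
        b₂.flatMap (chainTable (A.map top)))) ++
      table (A.map top ++ [top (b₁ ++ (c₁ ++ w :: c₂) :: b₂)]) C) := by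
    rw [hS, table_append, table, List.nil_append, List.flatMap_append, List.flatMap_cons,
      chainTable_append, hl]
  have hlcut : ∀ t, t ∈ l ↔ 0 < t ∧ t < w ∧ SlotCut p t w :=
    h.cut w l (by rw [htab]; simp [chainTable])
  have hflat : (SlotState.pick A C b₂ c₁ w c₂).flatten.flatten =
      (l ++ [w]) ++ (w :: R).map Nat.succ := by
    simp only [SlotState.pick, List.flatten_cons, List.flatten_append, flatten_shift, hR, hl,
      List.map_cons, List.map_append, List.map_flatten, List.append_assoc, List.cons_append,
      List.nil_append]
  have htop : top (b₁ ++ (c₁ ++ w :: c₂) :: b₂) ∈ w :: R := by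
    have e : (b₁ ++ (c₁ ++ w :: c₂) :: b₂).flatten =
        (b₁.flatten ++ c₁) ++ (w :: (c₂ ++ b₂.flatten)) := by simp
    have h1 : (w :: (c₂ ++ b₂.flatten)) ≠ [] := by simp
    rw [top, e, List.getLastD_eq_getLast?, List.getLast?_append_of_ne_nil _ h1,
      List.getLast?_eq_some_getLast h1, Option.getD_some]
    have h2 := List.getLast_mem h1
    rw [hR, List.append_assoc, List.mem_cons, ← List.append_assoc, List.mem_append]
    rcases List.mem_cons.1 h2 with h2 | h2
    · exact Or.inl h2
    · exact Or.inr (Or.inl h2)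
  constructor
  · exact avoids1342_appendLast.2 ⟨h.avoids, hactive⟩
  · rw [hflat, List.pairwise_append, List.pairwise_append, List.pairwise_map]
    refine ⟨⟨hQs.sublist hlQ, by simp, fun a ha b hb => ?_⟩,
      hRs.imp fun hab => Nat.succ_lt_succ hab, fun a ha b hb => ?_⟩
    · rw [List.mem_singleton.1 hb]; exact hlw a ha
    · obtain ⟨b', hb', rfl⟩ := List.mem_map.1 hb
      have h1 := hRw b' hb'
      rcases List.mem_append.1 ha with ha | ha
      · have := hlw a ha; omega
      · rw [List.mem_singleton.1 ha]; omega
  · intro s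
    rw [hflat, List.mem_append, List.mem_append, List.mem_singleton]
    rcases le_or_gt s w with hs | hs
    · rw [activeSlot_appendLast_of_le hactive (by omega), ← hw]
      have h1 : s ∉ (w :: R).map Nat.succ := by
        intro h1
        obtain ⟨b, hb, rfl⟩ := List.mem_map.1 h1
        have := hRw b hb; omega
      rw [or_iff_left h1, hlcut]
      rcases Nat.eq_zero_or_pos s with rfl | hs0
      · simp [slotCut_zero]
      · rcases eq_or_lt_of_le hs with rfl | hs1
        · simp [slotCut_self]
        · simp [hs0, hs1, hs0.ne', hs1.ne]
    · rw [activeSlot_appendLast_of_gt (by omega), h.active, hF, List.mem_append]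
      obtain ⟨s, rfl⟩ : ∃ s', s = s' + 1 := ⟨s - 1, by omega⟩
      have h1 : s ∉ Q := fun h1 => by have := hQw s h1; omega
      have h2 : s + 1 ∉ l := fun h1 => by have := hlw _ h1; omega
      rw [succ_mem_map_succ, Nat.add_sub_cancel]
      have h4 : s ≠ 0 := by omega
      have h5 : s + 1 ≠ w := by omega
      simp [h1, h2, h4, h5]
  · intro s hs
    rw [hflat, List.mem_append, List.mem_append, List.mem_singleton] at hs
    rcases hs with (hs | hs) | hs
    · exact ((hlcut s).1 hs).1
    · omega
    · obtain ⟨b, hb, rfl⟩ := List.mem_map.1 hs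
      exact Nat.succ_pos b
  · intro s k hsk t
    -- Slots above `v` come from slots of `p`, and the cuts below `v` disappear.
    have upper : ∀ l₀ s' k', s = s' + 1 → k = k'.map Nat.succ → (s', l₀ ++ k') ∈ table [] S →
        (∀ t ∈ l₀, t < w) → (∀ t ∈ k', t ∈ w :: R) → s' ∈ w :: R →
        (t ∈ k ↔ 0 < t ∧ t < s ∧ SlotCut (appendLast v p) t s) := by
      rintro l₀ s' k' rfl rfl he hl₀ hk' hs'
      have hsw := hRw s' hs'
      rcases Nat.eq_zero_or_pos t with rfl | ht
      · simp
      obtain ⟨t, rfl⟩ : ∃ t', t = t' + 1 := ⟨t - 1, by omega⟩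
      have hc := h.cut s' _ he t
      rw [List.mem_append] at hc
      rw [succ_mem_map_succ]
      constructor
      · intro htk
        obtain ⟨h1, h2, h3⟩ := hc.1 (Or.inr htk)
        have h4 := hRw t (hk' t htk)
        refine ⟨ht, by omega, ?_⟩
        rw [slotCut_appendLast_of_gt (by omega) ht (by omega)]
        exact ⟨by omega, h3⟩
      · rintro ⟨-, h1, h2⟩
        rw [slotCut_appendLast_of_gt (by omega) ht (by omega)] at h2
        rcases hc.2 ⟨by omega, by omega, h2.2⟩ with h3 | h3
        · have := hl₀ t h3; omega
        · exact h3
    have hAw : ∀ t ∈ A.map top, t < w := fun t ht => hlw t (by rw [hl]; simp [ht])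
    have hpick : table [] (SlotState.pick A C b₂ c₁ w c₂) = chainTable [] (l ++ [w]) ++
        ((chainTable [] (w :: c₂)).map (fun e => (e.1 + 1, e.2.map Nat.succ)) ++
          b₂.flatMap (fun c => (chainTable [] c).map fun e => (e.1 + 1, e.2.map Nat.succ))) ++
        (table [top (b₁ ++ (c₁ ++ w :: c₂) :: b₂)] C).map
          fun e => (e.1 + 1, e.2.map Nat.succ) := by
      have h1 : top ((A.map top ++ c₁ ++ [w]) :: (w :: c₂).map Nat.succ ::
          b₂.map (List.map Nat.succ)) = (top (b₁ ++ (c₁ ++ w :: c₂) :: b₂)).succ := by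
        have e1 : ((A.map top ++ c₁ ++ [w]) :: (w :: c₂).map Nat.succ ::
          b₂.map (List.map Nat.succ)).flatten =
            (l ++ [w]) ++ (((w :: c₂) :: b₂).map (List.map Nat.succ)).flatten := by
          simp [hl]
        have e2 : (b₁ ++ (c₁ ++ w :: c₂) :: b₂).flatten =
            (b₁.flatten ++ c₁) ++ ((w :: c₂) :: b₂).flatten := by simp
        rw [top, top, e1, e2, List.getLastD_eq_getLast?, List.getLastD_eq_getLast?,
          List.getLast?_append_of_ne_nil _ (by simp), List.getLast?_append_of_ne_nil _ (by simp),
          ← List.getLastD_eq_getLast?, ← List.getLastD_eq_getLast?]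
        exact top_map (by simp)
      have h2 := table_shift [top (b₁ ++ (c₁ ++ w :: c₂) :: b₂)] hneC
      rw [SlotState.pick, table, h1, List.nil_append]
      rw [List.map_singleton] at h2
      rw [h2, ← hl, List.flatMap_cons, List.flatMap_cons, List.flatMap_map]
      have h3 : ∀ c, chainTable [] (c.map Nat.succ) =
          (chainTable [] c).map fun e => (e.1 + 1, e.2.map Nat.succ) :=
        chainTable_map Nat.succ []
      simp only [h3]
    rw [hpick, List.mem_append, List.mem_append, List.mem_append] at hsk
    rcases hsk with (hsk | hsk | hsk) | hsk
    · obtain ⟨d₁, d₂, hd, hk⟩ := mem_chainTable.1 hsk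
      have hk' : d₁ = k := hk.symm
      subst hk'
      have hd_sorted : (d₁ ++ s :: d₂).Pairwise (· < ·) := by
        rw [← hd, List.pairwise_append]
        exact ⟨hQs.sublist hlQ, by simp, fun a ha b hb => by
          rw [List.mem_singleton.1 hb]; exact hlw a ha⟩
      rw [List.pairwise_append] at hd_sorted
      obtain ⟨-, hd2, hd1⟩ := hd_sorted
      have hs : s ∈ l ++ [w] := by rw [hd]; simp
      have hsw : s ≤ w ∧ SlotCut p s w := by
        rcases List.mem_append.1 hs with hs | hs
        · exact ⟨(hlw s hs).le, ((hlcut s).1 hs).2.2⟩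
        · rw [List.mem_singleton.1 hs]; exact ⟨le_rfl, slotCut_self p w⟩
      have hmem : t ∈ d₁ ↔ t < s ∧ t ∈ l := by
        constructor
        · intro ht
          have h1 := hd1 t ht s List.mem_cons_self
          have h2 : t ∈ l ++ [w] := by rw [hd]; simp [ht]
          refine ⟨h1, (List.mem_append.1 h2).resolve_right fun h3 => ?_⟩
          rw [List.mem_singleton.1 h3] at h1; omega
        · rintro ⟨h1, h2⟩
          have h3 : t ∈ d₁ ++ s :: d₂ := by rw [← hd]; simp [h2]
          rcases List.mem_append.1 h3 with h3 | h3
          · exact h3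
          · rcases List.mem_cons.1 h3 with rfl | h3
            · omega
            · have := (List.pairwise_cons.1 hd2).1 t h3; omega
      rw [hmem, hlcut]
      by_cases hts : t < s
      · rw [slotCut_appendLast_of_le (by omega) hts.le,
          slotCut_iff_of_slotCut hts.le hsw.1 hsw.2]
        have : t < w := by omega
        simp [hts, this]
      · simp [hts]
    · obtain ⟨⟨s', k'⟩, he, hsk⟩ := List.mem_map.1 hsk
      obtain ⟨rfl, rfl⟩ := Prod.mk.inj hsk
      have h1 := chainTable_append_left l [] (w :: c₂)
      rw [List.append_nil] at h1
      obtain ⟨d₁, d₂, hd, hk⟩ := mem_chainTable.1 he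
      have hsub : ∀ t ∈ w :: c₂, t ∈ w :: R := by
        intro t ht
        rw [hR]
        simp only [List.mem_cons, List.mem_append] at ht ⊢
        tauto
      refine upper l s' k' rfl rfl ?_ hlw (fun t ht => hsub t ?_) (hsub s' ?_)
      · have : (s', l ++ k') ∈ chainTable l (w :: c₂) := by
          rw [h1]; exact List.mem_map.2 ⟨_, he, rfl⟩
        rw [htab]
        simp only [List.mem_append, this, true_or, or_true]
      · rw [hk] at ht; rw [hd]; simp at ht; simp [ht]
      · rw [hd]; simp
    · obtain ⟨c, hc, hsk⟩ := List.mem_flatMap.1 hsk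
      obtain ⟨⟨s', k'⟩, he, hsk⟩ := List.mem_map.1 hsk
      obtain ⟨rfl, rfl⟩ := Prod.mk.inj hsk
      have h1 := chainTable_append_left (A.map top) [] c
      rw [List.append_nil] at h1
      obtain ⟨d₁, d₂, hd, hk⟩ := mem_chainTable.1 he
      have hsub : ∀ t ∈ c, t ∈ w :: R := by
        intro t ht
        have : t ∈ b₂.flatten := List.mem_flatten.2 ⟨c, hc, ht⟩
        rw [hR]
        simp only [List.mem_cons, List.mem_append]
        tauto
      refine upper (A.map top) s' k' rfl rfl ?_ hAw (fun t ht => hsub t ?_) (hsub s' ?_)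
      · have : (s', A.map top ++ k') ∈ b₂.flatMap (chainTable (A.map top)) := by
          refine List.mem_flatMap.2 ⟨c, hc, ?_⟩
          rw [h1]; exact List.mem_map.2 ⟨_, he, rfl⟩
        rw [htab]
        simp only [List.mem_append, this, true_or, or_true]
      · rw [hk] at ht; rw [hd]; simp at ht; simp [ht]
      · rw [hd]; simp
    · obtain ⟨⟨s', k'⟩, he, hsk⟩ := List.mem_map.1 hsk
      obtain ⟨rfl, rfl⟩ := Prod.mk.inj hsk
      obtain ⟨h2, h3⟩ := mem_of_mem_table hneC he
      have hsub : ∀ t ∈ C.flatten.flatten, t ∈ w :: R := by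
        intro t ht
        rw [hR]
        simp only [List.mem_cons, List.mem_append]
        tauto
      refine upper (A.map top) s' k' rfl rfl ?_ hAw (fun t ht => ?_) (hsub s' h2)
      · have : (s', A.map top ++ k') ∈
            table (A.map top ++ [top (b₁ ++ (c₁ ++ w :: c₂) :: b₂)]) C := by
          rw [table_append_left]; exact List.mem_map.2 ⟨_, he, rfl⟩
        rw [htab]
        simp only [List.mem_append, this, or_true]
      · rcases h3 t ht with h4 | h4
        · rw [List.mem_singleton.1 h4]; exact htop
        · exact hsub t h4
  · intro B hB
    rcases List.mem_cons.1 hB with rfl | hB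
    · obtain ⟨b, t, hb⟩ := h.blocks (b₁ ++ (c₁ ++ w :: c₂) :: b₂) (by simp [hS])
      rcases List.eq_nil_or_concat b₂ with rfl | ⟨b₂', d, rfl⟩
      · have h1 := (List.append_inj' hb rfl).2
        have h2 : c₁ ++ w :: c₂ = [t] := by simpa using h1
        have h3 : c₁ = [] ∧ c₂ = [] := by
          have := congrArg List.length h2
          simp only [List.length_append, List.length_cons, List.length_nil] at this
          exact ⟨List.length_eq_zero_iff.1 (by omega), List.length_eq_zero_iff.1 (by omega)⟩
        exact ⟨[A.map top ++ c₁ ++ [w]], w + 1, by simp [h3.2]⟩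
      · have h1 : b₁ ++ (c₁ ++ w :: c₂) :: (b₂' ++ [d]) =
            (b₁ ++ (c₁ ++ w :: c₂) :: b₂') ++ [d] := by simp
        rw [List.concat_eq_append, h1] at hb
        have h2 := (List.append_inj' hb rfl).2
        have h3 : d = [t] := by simpa using h2
        exact ⟨(A.map top ++ c₁ ++ [w]) :: (w :: c₂).map Nat.succ ::
          b₂'.map (List.map Nat.succ), t + 1, by simp [h3]⟩
    · exact blocks_shift (fun B hB => h.blocks B (by simp [hS, hB])) B hB

end SlotState

/-! ### Counting the indecomposable permutations that avoid 1342 -/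

namespace SlotState

variable {m : ℕ} {p : Equiv.Perm (Fin m)} {S : SlotState ℕ}

/-- The topmost slot is cut at the largest slots of all blocks but the last one in the list. -/
theorem IsStateOf.isIndecomposable_iff (h : S.IsStateOf p) (hm : 0 < m) :
    IsIndecomposable p ↔ S.length = 1 := by
  have hmF : m ∈ S.flatten.flatten := ((h.active m).1 (activeSlot_top p)).resolve_left hm.ne'
  rcases List.eq_nil_or_concat S with rfl | ⟨C, B, rfl⟩
  · simp at hmF
  rw [List.concat_eq_append] at h hmF ⊢
  obtain ⟨b, t, rfl⟩ := h.blocks B (by simp)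
  have hflat : (C ++ [b ++ [[t]]]).flatten.flatten = (C.flatten.flatten ++ b.flatten) ++ [t] := by
    simp
  have ht : t = m := by
    have h1 : t ≤ m := ((h.active t).2 (Or.inr (by simp))).1
    rw [hflat] at hmF
    rcases List.mem_append.1 hmF with h2 | h2
    · have hs := h.sorted
      rw [hflat, List.pairwise_append] at hs
      have := hs.2.2 m h2 t (by simp)
      omega
    · exact (List.mem_singleton.1 h2).symm
  subst ht
  have hcut := h.cut t (C.map top) (by
    rw [table_append]
    simp [table, chainTable])
  rw [isIndecomposable_iff_slotCut]
  have : (¬ ∃ u, 0 < u ∧ u < t ∧ SlotCut p u t) ↔ C.map top = [] := by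
    rw [List.eq_nil_iff_forall_not_mem]
    simp only [hcut, not_exists]
  rw [this]
  simp

open Classical in
/-- The number of indecomposable permutations avoiding `1342` that arise from `p` by appending `k`
entries; the empty permutation is not counted. -/
noncomputable def extensionCount : ℕ → ∀ {m : ℕ}, Equiv.Perm (Fin m) → ℕ
  | 0, m, p => if 0 < m ∧ IsIndecomposable p ∧ Avoids1342 p then 1 else 0
  | k + 1, m, p => ∑ v : Fin (m + 1), extensionCount k (appendLast v p)

theorem extensionCount_eq_zero (k : ℕ) {m : ℕ} {p : Equiv.Perm (Fin m)} (hp : ¬ Avoids1342 p) :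
    extensionCount k p = 0 := by
  induction k generalizing m with
  | zero => simp [extensionCount, hp]
  | succ k ih =>
    rw [extensionCount]
    exact Finset.sum_eq_zero fun v _ => ih fun h => hp (avoids1342_appendLast.1 h).1

/-- Every permutation of length `n` extends exactly one permutation of length `m ≤ n`. -/
theorem sum_extensionCount (k : ℕ) {m n : ℕ} (h : m + k = n) :
    ∑ p : Equiv.Perm (Fin m), extensionCount k p =
      ∑ q : Equiv.Perm (Fin n), extensionCount 0 q := by
  induction k generalizing m with
  | zero => subst h; rfl
  | succ k ih =>
    rw [← ih (m := m + 1) (by omega), ← (appendLast_bijective (m := m)).sum_comp,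
      Fintype.sum_prod_type_right]
    rfl

theorem sum_flatten_flatten_eq_sum_splits {R : Type*} [AddCommMonoid R] (S : SlotState ℕ)
    (f : ℕ → R) : (S.flatten.flatten.map f).sum =
      (S.splits.map fun Y => (Y.2.1.splits.map fun y =>
        (y.2.1.splits.map fun z => f z.2.1).sum).sum).sum := by
  have h1 : ∀ c : List ℕ, (c.splits.map fun z => f z.2.1).sum = (c.map f).sum :=
    fun c => List.sum_map_splits c f
  have h2 : ∀ B : List (List ℕ), (B.splits.map fun y => (y.2.1.map f).sum).sum =
      (B.map fun c => (c.map f).sum).sum :=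
    fun B => List.sum_map_splits B fun c => (c.map f).sum
  simp only [h1, h2]
  rw [List.sum_map_splits S fun B => (B.map fun c => (c.map f).sum).sum]
  simp only [List.map_flatten, List.sum_flatten, List.map_map, Function.comp_def]

theorem IsStateOf.sum_eq {R : Type*} [AddCommMonoid R] (h : S.IsStateOf p) (f : ℕ → R)
    (hf : ∀ s ≤ m, ¬ ActiveSlot p s → f s = 0) :
    ∑ v : Fin (m + 1), f v = f 0 + (S.flatten.flatten.map f).sum := by
  have hnodup : (0 :: S.flatten.flatten).Nodup := by
    rw [List.nodup_cons]
    exact ⟨fun h0 => (h.pos 0 h0).false, h.sorted.imp fun hab => hab.ne⟩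
  rw [← List.sum_cons, ← List.map_cons, ← List.sum_toFinset _ hnodup, Fin.sum_univ_eq_sum_range]
  symm
  apply Finset.sum_subset
  · intro s hs
    have h1 : ActiveSlot p s := (h.active s).2 (by simpa using hs)
    exact Finset.mem_range.2 (Nat.lt_succ_of_le h1.1)
  · intro s hs hs'
    refine hf s (Nat.lt_succ_iff.1 (Finset.mem_range.1 hs)) fun h1 => hs' ?_
    simpa using (h.active s).1 h1

open PowerSeries in
/-- The weight of a state is the generating series of the extensions of a permutation with this
state. -/
theorem coeff_weight {P K : ℕ → ℚ⟦X⟧} (hK : ∀ e, K e = P (e + 1) + X * P 1 * K (e + 1))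
    (hP : ∀ d, P d = 1 + X * ∑ e ∈ Finset.range d, K e * P (d - e)) (k : ℕ) {m : ℕ}
    {p : Equiv.Perm (Fin m)} {S : SlotState ℕ} (h : S.IsStateOf p) :
    coeff k (weight X P K S 0) = extensionCount k p := by
  induction k generalizing m S with
  | zero =>
    have h1 : (0 < m ∧ IsIndecomposable p ∧ Avoids1342 p) ↔ S.length = 1 := by
      constructor
      · rintro ⟨h1, h2, -⟩; exact (h.isIndecomposable_iff h1).1 h2
      · intro h1
        have hm : 0 < m := by
          rcases Nat.eq_zero_or_pos m with rfl | hm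
          · obtain ⟨B, rfl⟩ := List.length_eq_one_iff.1 h1
            obtain ⟨b, t, rfl⟩ := h.blocks B (by simp)
            have h2 := (h.active t).2 (Or.inr (by simp))
            have h3 := h.pos t (by simp)
            exact absurd h2.1 (by omega)
          · exact hm
        exact ⟨hm, (h.isIndecomposable_iff hm).2 h1, h.avoids⟩
    rw [weight_eq hK hP, map_add, coeff_zero_X_mul, extensionCount]
    simp only [h1]
    split_ifs <;> simp
  | succ k ih =>
    rw [weight_eq hK hP, map_add, coeff_succ_X_mul, map_add, extensionCount]
    have h1 : coeff (k + 1) (if S.length = 1 then 1 else 0 : ℚ⟦X⟧) = 0 := by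
      split_ifs <;> simp [coeff_one]
    rw [h1, zero_add, ih h.push]
    -- The number of extensions as a function of the slot, zero beyond the topmost one.
    let f : ℕ → ℚ := fun s =>
      if hs : s < m + 1 then (extensionCount k (appendLast ⟨s, hs⟩ p) : ℚ) else 0
    have hfv : ∀ v : Fin (m + 1), (extensionCount k (appendLast v p) : ℚ) = f v := by
      intro v; simp only [f, v.isLt, dif_pos]
    have hf : ∀ s ≤ m, ¬ ActiveSlot p s → f s = 0 := by
      intro s hs hact
      have hs' : s < m + 1 := by omega
      simp only [f, hs', dif_pos]
      rw [extensionCount_eq_zero, Nat.cast_zero]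
      exact fun h' => hact (avoids1342_appendLast.1 h').2
    push_cast
    simp only [hfv]
    rw [h.sum_eq f hf, Fin.val_zero, sum_flatten_flatten_eq_sum_splits]
    congr 1
    rw [map_list_sum, List.map_map]
    congr 1
    refine List.map_congr_left fun Y hY => ?_
    rw [Function.comp_apply, map_list_sum, List.map_map]
    congr 1
    refine List.map_congr_left fun y hy => ?_
    rw [Function.comp_apply, map_list_sum, List.map_map]
    congr 1
    refine List.map_congr_left fun z hz => ?_
    obtain ⟨A, B, C⟩ := Y
    obtain ⟨b₁, c, b₂⟩ := y
    obtain ⟨c₁, s, c₂⟩ := z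
    have hB := List.mem_splits.1 hY
    have hc := List.mem_splits.1 hy
    have hz' := List.mem_splits.1 hz
    simp only at hc hz'
    subst hc hz'
    have hs : s < m + 1 :=
      Nat.lt_succ_of_le ((h.active s).2 (Or.inr (by simp [hB]))).1
    have h2 := ih (h.pick (v := ⟨s, hs⟩) hB)
    simp only [Function.comp_apply, f, hs, dif_pos]
    exact h2

theorem ncard_indecomposable1342Avoiders {n : ℕ} (hn : 1 ≤ n) :
    ((indecomposable1342Avoiders n).ncard : ℚ) =
      PowerSeries.coeff (n - 1) BicubicSeries.series := by
  classical
  obtain ⟨P, K, hP1, hK, hP⟩ := BicubicSeries.exists_weights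
  have h1 := coeff_weight hK hP n (isStateOf_nil 1)
  have h2 : ∑ q : Equiv.Perm (Fin n), extensionCount 0 q =
      (indecomposable1342Avoiders n).ncard := by
    rw [Set.ncard_eq_toFinset_card']
    simp only [extensionCount, Finset.sum_boole, Nat.cast_id]
    congr 1
    ext q
    rw [Finset.mem_filter, Set.mem_toFinset]
    simp [indecomposable1342Avoiders, avoidsPattern_iff, Nat.lt_of_succ_le hn]
  have h3 := sum_extensionCount n (m := 0) (n := n) (by simp)
  rw [h2, Fintype.sum_unique] at h3
  rw [← h3]
  obtain ⟨n, rfl⟩ : ∃ n', n = n' + 1 := ⟨n - 1, by omega⟩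
  rw [weight, PowerSeries.coeff_succ_X_mul, hP1] at h1
  rw [Nat.add_sub_cancel, h1, Subsingleton.elim default (1 : Equiv.Perm (Fin 0))]

end SlotState

/-! ### The functional equation of the tree series -/

namespace BicubicSeries

open PowerSeries

/-- Setting the inner variable `t = u - 1` to zero in a power series in `X` over `ℚ⟦t⟧`. -/
noncomputable def evalOne : ℚ⟦X⟧⟦X⟧ →+* ℚ⟦X⟧⟦X⟧ :=
  PowerSeries.map ((C : ℚ →+* ℚ⟦X⟧).comp constantCoeff)

/-- The functional equation of the series `Ψ` of `β(0,1)`-trees, where `X` marks the edges and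
`u = 1 + t` the label of the root. -/
def TreeEquation (Ψ : ℚ⟦X⟧⟦X⟧) : Prop :=
  (1 - C (1 + X)) * (Ψ - 1) =
    X * Ψ * (evalOne Ψ - C (1 + X) + C (1 + X) ^ 2 - C (1 + X) ^ 2 * Ψ)

/-- Two solutions that agree modulo `X ^ n` agree modulo `X ^ (n + 1)`: the difference `D` satisfies
`-t D = X (…)`, where the bracket is divisible by `X ^ n`. -/
theorem TreeEquation.unique {Ψ Θ : ℚ⟦X⟧⟦X⟧} (hΨ : TreeEquation Ψ) (hΘ : TreeEquation Θ) :
    Ψ = Θ := by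
  rw [TreeEquation] at hΨ hΘ
  generalize hu : (C (1 + X) : ℚ⟦X⟧⟦X⟧) = u at *
  have hu1 : 1 - u = -C X := by rw [← hu, map_add, map_one]; ring
  have key : ∀ n : ℕ, (X : ℚ⟦X⟧⟦X⟧) ^ n ∣ Ψ - Θ := by
    intro n
    induction n with
    | zero => simp
    | succ n ih =>
      have h1 : (X : ℚ⟦X⟧⟦X⟧) ^ n ∣ evalOne Ψ - evalOne Θ := by
        have := map_dvd evalOne ih
        simpa [evalOne] using this
      have h2 : C X * (Ψ - Θ) = X * ((Ψ - Θ) * -(evalOne Ψ - u + u ^ 2 - u ^ 2 * Ψ) -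
          (evalOne Ψ - evalOne Θ) * Θ + (Ψ - Θ) * (u ^ 2 * Θ)) := by
        linear_combination -hΨ + hΘ + (Ψ - Θ) * hu1
      have h3 : (X : ℚ⟦X⟧⟦X⟧) ^ (n + 1) ∣ C X * (Ψ - Θ) := by
        rw [h2, pow_succ']
        exact mul_dvd_mul_left _ (dvd_add (dvd_sub (ih.mul_right _) (h1.mul_right _))
          (ih.mul_right _))
      rw [X_pow_dvd_iff] at h3 ⊢
      intro m hm
      have h4 := h3 m hm
      rw [coeff_C_mul] at h4
      exact (mul_eq_zero.1 h4).resolve_left X_ne_zero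
  rw [← sub_eq_zero]
  ext1 n
  exact X_pow_dvd_iff.1 (key (n + 1)) n (Nat.lt_succ_self n)

theorem isUnit_of_constantCoeff_eq_one {a : ℚ⟦X⟧⟦X⟧} (h : constantCoeff a = 1) : IsUnit a := by
  rw [PowerSeries.isUnit_iff_constantCoeff, h]
  exact isUnit_one

/-- The explicit solution of the functional equation.  The discriminant of the quadratic equation
for `Ψ` has the double root `U = (1 - T) / (1 - 2 T)`; up to this factor its square root is
`M - 2 δ` with `M = (1 - T)² - X u` and `δ (M - δ) = X u T (1 - T)`. -/
theorem exists_treeEquation :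
    ∃ Ψ, TreeEquation Ψ ∧ evalOne Ψ = PowerSeries.map (C : ℚ →+* ℚ⟦X⟧) series := by
  have h1 : PowerSeries.map (C : ℚ →+* ℚ⟦X⟧) tau *
      (1 - 2 * PowerSeries.map (C : ℚ →+* ℚ⟦X⟧) param) = 1 := by
    have := congrArg (PowerSeries.map (C : ℚ →+* ℚ⟦X⟧)) tau_mul
    simpa only [map_mul, map_sub, map_one, map_ofNat] using this
  have h2 : PowerSeries.map (C : ℚ →+* ℚ⟦X⟧) param =
      X * PowerSeries.map (C : ℚ →+* ℚ⟦X⟧) tau := by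
    rw [param_eq, map_mul, map_X]
  have h3 : PowerSeries.map (C : ℚ →+* ℚ⟦X⟧) series *
      (1 - 2 * PowerSeries.map (C : ℚ →+* ℚ⟦X⟧) param) ^ 2 =
      1 - 3 * PowerSeries.map (C : ℚ →+* ℚ⟦X⟧) param +
        PowerSeries.map (C : ℚ →+* ℚ⟦X⟧) param ^ 2 := by
    have := congrArg (PowerSeries.map (C : ℚ →+* ℚ⟦X⟧)) series_mul
    simpa only [map_mul, map_sub, map_add, map_pow, map_one, map_ofNat] using this
  have hev : ∀ f : ℚ⟦X⟧, evalOne (PowerSeries.map (C : ℚ →+* ℚ⟦X⟧) f) =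
      PowerSeries.map (C : ℚ →+* ℚ⟦X⟧) f := by
    intro f; ext1 n; simp [evalOne]
  have hevT := hev param
  have hevs := hev tau
  have hT0 : constantCoeff (PowerSeries.map (C : ℚ →+* ℚ⟦X⟧) param) = 0 := by
    rw [h2]; simp
  have hevX : evalOne (X : ℚ⟦X⟧⟦X⟧) = X := by simp [evalOne]
  obtain ⟨u, hu⟩ : ∃ u : ℚ⟦X⟧⟦X⟧, u = C (1 + X) := ⟨_, rfl⟩
  have hevu : evalOne u = 1 := by rw [hu, evalOne, map_C]; simp
  have huu : IsUnit u := by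
    rw [hu, PowerSeries.isUnit_iff_constantCoeff, constantCoeff_C,
      PowerSeries.isUnit_iff_constantCoeff]
    simp
  obtain ⟨iu, hiu⟩ := huu.exists_left_inv
  generalize PowerSeries.map (C : ℚ →+* ℚ⟦X⟧) series = F at *
  generalize PowerSeries.map (C : ℚ →+* ℚ⟦X⟧) param = T at *
  generalize PowerSeries.map (C : ℚ →+* ℚ⟦X⟧) tau = s at *
  have hM : IsUnit ((1 - T) ^ 2 - X * u) := isUnit_of_constantCoeff_eq_one (by simp [hT0])
  have hT2 : IsUnit (1 - 2 * T) := isUnit_of_constantCoeff_eq_one (by simp [hT0])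
  obtain ⟨i, hi⟩ := hM.exists_left_inv
  obtain ⟨y, hy⟩ := exists_eq_add_X_mul_sq (u * T * (1 - T) * i) i
  have hyM : y * ((1 - T) ^ 2 - X * u) = u * T * (1 - T) + X * y ^ 2 := by
    linear_combination ((1 - T) ^ 2 - X * u) * hy + (u * T * (1 - T) + X * y ^ 2) * hi
  obtain ⟨Ψ, hΨ⟩ : ∃ Ψ, Ψ = 1 + (s * T * u - ((1 - T) * s - u) * y) * iu ^ 2 := ⟨_, rfl⟩
  have hx : X = T * (1 - 2 * T) := by rw [h2]; rw [h2] at h1; linear_combination -X * h1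
  -- At `u = 1` the quadratic equation has the root `δ = T²`, that is, `y = T² / X`.
  have hy1 : evalOne y = s * T := by
    have h4 := congrArg evalOne hyM
    simp only [map_mul, map_sub, map_add, map_pow, map_one, hevT, hevX, hevu] at h4
    have h5 : IsUnit ((1 - T) ^ 2 - X - X * (evalOne y + s * T)) :=
      isUnit_of_constantCoeff_eq_one (by simp [hT0])
    apply sub_eq_zero.1
    apply mul_right_cancel₀ h5.ne_zero
    linear_combination h4 - (T + s * T ^ 2) * h2 - T * h1
  have hΨ1 : evalOne Ψ = F := by
    have hiu1 : evalOne iu = 1 := by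
      have := congrArg evalOne hiu
      simpa [hevu] using this
    rw [hΨ]
    simp only [map_mul, map_sub, map_add, map_pow, map_one, hevT, hevs, hevu, hiu1, hy1]
    apply mul_right_cancel₀ (pow_ne_zero 2 hT2.ne_zero)
    linear_combination -h3 + (T * (1 - 2 * T) * 2 - T * (1 - T) * (s * (1 - 2 * T) + 1)) * h1
  refine ⟨Ψ, ?_, hΨ1⟩
  rw [TreeEquation, hΨ1, ← hu]
  -- The equation holds after multiplication by `X u² (1 - 2 T)²`, where it reduces to `hq`.
  have hG : X * u ^ 2 * (Ψ - 1) * (1 - 2 * T) =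
      (1 - 2 * T) * T ^ 2 * u - (1 - T - (1 - 2 * T) * u) * (X * y) := by
    rw [hΨ]
    linear_combination (X * (s * T * u - ((1 - T) * s - u) * y) * (1 - 2 * T) * (iu * u + 1)) * hiu
      + (X * T * u - X * (1 - T) * y) * h1 + T * u * hx
  have hxF : X * F * (1 - 2 * T) = T * (1 - 3 * T + T ^ 2) := by
    apply mul_right_cancel₀ hT2.ne_zero
    linear_combination X * h3 + (1 - 3 * T + T ^ 2) * hx
  apply mul_right_cancel₀ (mul_ne_zero (mul_ne_zero (X_ne_zero (R := ℚ⟦X⟧))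
    (pow_ne_zero 2 huu.ne_zero)) (pow_ne_zero 2 hT2.ne_zero))
  obtain ⟨g, hg⟩ : ∃ g, g = Ψ - 1 := ⟨_, rfl⟩
  obtain rfl : Ψ = g + 1 := by rw [hg]; ring
  rw [add_sub_cancel_right] at hG ⊢
  obtain ⟨h, hh⟩ : ∃ h, h = X * u ^ 2 * g * (1 - 2 * T) := ⟨_, rfl⟩
  obtain ⟨d, hd⟩ : ∃ d, d = X * y := ⟨_, rfl⟩
  have hq : d * ((1 - T) ^ 2 - X * u) = X * u * T * (1 - T) + d ^ 2 := by
    rw [hd]; linear_combination X * hyM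
  rw [← hh, ← hd] at hG
  have e : (1 - u) * (1 - 2 * T) * h =
      ((1 - 2 * T) * X * u ^ 2 + h) * (X * F * (1 - 2 * T) - (1 - 2 * T) * X * u - h) := by
    rw [hxF, hG]
    generalize (X : ℚ⟦X⟧⟦X⟧) = x at *
    subst hx
    linear_combination (-(1 - T - (1 - 2 * T) * u) ^ 2) * hq
  rw [hh] at e
  linear_combination e

end BicubicSeries

/-! ### Counting the trees -/

namespace LabeledPlaneTree

/-- The number of labels that a vertex other than the root can carry above the forest `ts`. -/
def labelBound (ts : List LabeledPlaneTree) : ℕ :=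
  if ts = [] then 1 else (ts.map rootLabel).sum + 2

theorem isNonrootAdmissible_node {l : ℕ} {ts : List LabeledPlaneTree} :
    IsNonrootAdmissible (node l ts) ↔
      l < labelBound ts ∧ ∀ t ∈ ts, IsNonrootAdmissible t := by
  rw [labelBound]
  constructor
  · intro h
    cases h with
    | leaf => simp
    | internal _ _ hne hl hts => rw [if_neg hne]; exact ⟨by omega, hts⟩
  · rintro ⟨hl, hts⟩
    by_cases hne : ts = []
    · subst hne
      rw [if_pos rfl, Nat.lt_one_iff] at hl
      subst hl
      exact .leaf
    · rw [if_neg hne] at hl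
      exact .internal l ts hne (by omega) hts

theorem numVertices_node (l : ℕ) (ts : List LabeledPlaneTree) :
    numVertices (node l ts) = 1 + (ts.map numVertices).sum := by
  rw [numVertices]

/-- The forests of admissible trees with `n` vertices in total. -/
def forests (n : ℕ) : Set (List LabeledPlaneTree) :=
  {ts | (∀ t ∈ ts, IsNonrootAdmissible t) ∧ (ts.map numVertices).sum = n}

theorem cons_mem_forests {n l : ℕ} {s r : List LabeledPlaneTree} :
    node l s :: r ∈ forests n ↔
      ∃ a b, a + b + 1 = n ∧ s ∈ forests a ∧ r ∈ forests b ∧ l < labelBound s := by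
  simp only [forests, Set.mem_ofPred_eq, List.forall_mem_cons, isNonrootAdmissible_node,
    List.map_cons, List.sum_cons, numVertices_node]
  constructor
  · rintro ⟨⟨⟨h1, h2⟩, h3⟩, h4⟩
    exact ⟨_, _, by omega, ⟨h2, rfl⟩, ⟨h3, rfl⟩, h1⟩
  · rintro ⟨a, b, h, ⟨h1, rfl⟩, ⟨h2, rfl⟩, h3⟩
    exact ⟨⟨⟨h3, h1⟩, h2⟩, by omega⟩

theorem forests_zero : forests 0 = {[]} := by
  ext ts
  cases ts with
  | nil => simp [forests]
  | cons t r =>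
    obtain ⟨l, s⟩ := t
    rw [cons_mem_forests]
    simp

theorem nil_notMem_forests (n : ℕ) : [] ∉ forests (n + 1) := by
  simp [forests]

theorem finite_forests (n : ℕ) : (forests n).Finite := by
  induction n using Nat.strong_induction_on with
  | _ n ih =>
    cases n with
    | zero => rw [forests_zero]; exact Set.finite_singleton _
    | succ n =>
      have h : (⋃ a ∈ Set.Iio (n + 1), ⋃ b ∈ Set.Iio (n + 1), ⋃ s ∈ forests a, ⋃ r ∈ forests b,
          (fun l => node l s :: r) '' Set.Iio (labelBound s)).Finite :=
        (Set.finite_Iio _).biUnion fun a ha => (Set.finite_Iio _).biUnion fun b hb =>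
          (ih a ha).biUnion fun s _ => (ih b hb).biUnion fun r _ => (Set.finite_Iio _).image _
      refine h.subset ?_
      rintro (_ | ⟨⟨l, s⟩, r⟩) hts
      · exact absurd hts (nil_notMem_forests n)
      · obtain ⟨a, b, hab, hs, hr, hl⟩ := cons_mem_forests.1 hts
        simp only [Set.mem_iUnion]
        exact ⟨a, Set.mem_Iio.2 (by omega), b, Set.mem_Iio.2 (by omega), s, hs, r, hr, l, hl, rfl⟩

/-- The finite set of forests of admissible trees with `n` vertices in total. -/
noncomputable def forestFinset (n : ℕ) : Finset (List LabeledPlaneTree) :=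
  (finite_forests n).toFinset

theorem mem_forestFinset {n : ℕ} {ts : List LabeledPlaneTree} :
    ts ∈ forestFinset n ↔ ts ∈ forests n := by
  simp [forestFinset]

theorem forestFinset_zero : forestFinset 0 = {[]} := by
  ext ts; rw [mem_forestFinset, forests_zero]; simp

/-- A nonempty forest consists of the root label and the branches of its first tree, and of the
remaining trees. -/
theorem sum_forestFinset_succ {R : Type*} [AddCommMonoid R] (n : ℕ) (g : ℕ → R) :
    ∑ ts ∈ forestFinset (n + 1), g (ts.map rootLabel).sum =
      ∑ ab ∈ Finset.HasAntidiagonal.antidiagonal n, ∑ s ∈ forestFinset ab.1,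
        ∑ r ∈ forestFinset ab.2, ∑ l ∈ Finset.range (labelBound s), g (l + (r.map rootLabel).sum) := by
  simp only [Finset.sum_sigma']
  symm
  refine Finset.sum_bij (fun x _ => node x.2.2.2 x.2.1 :: x.2.2.1) ?_ ?_ ?_ ?_
  · rintro ⟨⟨a, b⟩, s, r, l⟩ h
    simp only [Finset.mem_sigma, Finset.HasAntidiagonal.mem_antidiagonal, mem_forestFinset,
      Finset.mem_range] at h
    obtain ⟨h1, h2, h3, h4⟩ := h
    rw [mem_forestFinset, cons_mem_forests]
    exact ⟨a, b, by omega, h2, h3, h4⟩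
  · rintro ⟨⟨a, b⟩, s, r, l⟩ h ⟨⟨a', b'⟩, s', r', l'⟩ h' heq
    simp only [Finset.mem_sigma, Finset.HasAntidiagonal.mem_antidiagonal, mem_forestFinset,
      Finset.mem_range] at h h'
    obtain ⟨h1, ⟨-, h2⟩, ⟨-, h3⟩, -⟩ := h
    obtain ⟨h1', ⟨-, h2'⟩, ⟨-, h3'⟩, -⟩ := h'
    simp only [List.cons.injEq, node.injEq] at heq
    obtain ⟨⟨rfl, rfl⟩, rfl⟩ := heq
    subst h2 h3 h2' h3'
    rfl
  · intro ts hts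
    rw [mem_forestFinset] at hts
    rcases ts with _ | ⟨⟨l, s⟩, r⟩
    · exact absurd hts (nil_notMem_forests n)
    · obtain ⟨a, b, hab, hs, hr, hl⟩ := cons_mem_forests.1 hts
      refine ⟨⟨(a, b), s, r, l⟩, ?_, rfl⟩
      simp only [Finset.mem_sigma, Finset.HasAntidiagonal.mem_antidiagonal, mem_forestFinset,
        Finset.mem_range]
      exact ⟨by omega, hs, hr, hl⟩
  · rintro ⟨⟨a, b⟩, s, r, l⟩ _
    simp [rootLabel]

open PowerSeries BicubicSeries

/-- The generating series of forests: `X` marks the vertices and `u = 1 + t` the sum of the labels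
of the roots. -/
noncomputable def forestSeries : ℚ⟦X⟧⟦X⟧ :=
  PowerSeries.mk fun n => ∑ ts ∈ forestFinset n, (1 + X : ℚ⟦X⟧) ^ (ts.map rootLabel).sum

/-- The generating series of admissible trees: `X` marks the vertices other than the root and
`u = 1 + t` the label of the root. -/
noncomputable def treeSeries : ℚ⟦X⟧⟦X⟧ :=
  PowerSeries.mk fun n => ∑ ts ∈ forestFinset n, ∑ l ∈ Finset.range (labelBound ts),
    (1 + X : ℚ⟦X⟧) ^ l

/-- A forest is empty or consists of a first tree and a forest. -/
theorem forestSeries_eq : forestSeries = 1 + X * treeSeries * forestSeries := by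
  ext1 n
  rw [map_add, mul_assoc]
  cases n with
  | zero => simp [forestSeries, forestFinset_zero]
  | succ n =>
    rw [coeff_succ_X_mul, coeff_mul, coeff_one, if_neg (Nat.succ_ne_zero n), zero_add]
    simp only [forestSeries, treeSeries, coeff_mk]
    rw [sum_forestFinset_succ n fun k => (1 + X : ℚ⟦X⟧) ^ k]
    refine Finset.sum_congr rfl fun ab _ => ?_
    rw [Finset.sum_mul]
    refine Finset.sum_congr rfl fun s _ => ?_
    rw [Finset.mul_sum]
    refine Finset.sum_congr rfl fun r _ => ?_
    rw [Finset.sum_mul]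
    simp only [pow_add]

theorem coeff_evalOne_forestSeries (n : ℕ) :
    coeff n (evalOne forestSeries) = C ((forestFinset n).card : ℚ) := by
  simp [evalOne, forestSeries]

/-- Summing the geometric progression of the labels allowed above each forest. -/
theorem mul_treeSeries : (1 - C (1 + X)) * treeSeries =
    (1 - C (1 + X)) + (evalOne forestSeries - 1) - C (1 + X) ^ 2 * (forestSeries - 1) := by
  have e1 : (1 - C (1 + X) : ℚ⟦X⟧⟦X⟧) = C (1 - (1 + X)) := by rw [map_sub, map_one]
  rw [e1, ← map_pow]
  ext1 n
  rw [coeff_C_mul, map_sub (coeff n), map_add (coeff n), map_sub (coeff n) (evalOne _),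
    coeff_C_mul, map_sub (coeff n), coeff_evalOne_forestSeries, treeSeries, forestSeries, coeff_mk,
    coeff_mk]
  cases n with
  | zero => simp [forestFinset_zero, labelBound]
  | succ n =>
    rw [coeff_C, if_neg (Nat.succ_ne_zero n), coeff_one, if_neg (Nat.succ_ne_zero n), zero_add,
      sub_zero, sub_zero, Finset.mul_sum, Finset.mul_sum]
    have e2 : (C ((forestFinset (n + 1)).card : ℚ) : ℚ⟦X⟧) =
        ∑ ts ∈ forestFinset (n + 1), 1 := by simp
    rw [e2, ← Finset.sum_sub_distrib]
    refine Finset.sum_congr rfl fun ts hts => ?_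
    have hne : ts ≠ [] := by
      rintro rfl
      exact nil_notMem_forests n (mem_forestFinset.1 hts)
    rw [labelBound, if_neg hne, mul_neg_geom_sum, pow_add]
    ring

theorem treeEquation_forestSeries : TreeEquation forestSeries := by
  rw [TreeEquation]
  have h1 := forestSeries_eq
  have h2 := mul_treeSeries
  linear_combination (1 - C (1 + X)) * h1 + X * forestSeries * h2

theorem card_forestFinset (n : ℕ) : ((forestFinset n).card : ℚ) = coeff n series := by
  obtain ⟨Ψ, h1, h2⟩ := exists_treeEquation
  rw [h1.unique treeEquation_forestSeries] at h2
  have h3 := congrArg (coeff n) h2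
  rw [coeff_evalOne_forestSeries, coeff_map] at h3
  exact C_injective h3

theorem beta01Trees_succ (n : ℕ) :
    beta01Trees (n + 1) = (fun ts => node (ts.map rootLabel).sum ts) '' forests n := by
  ext ⟨l, ts⟩
  simp only [beta01Trees, IsBeta01, forests, Set.mem_ofPred_eq, numVertices_node, Set.mem_image,
    node.injEq]
  constructor
  · rintro ⟨⟨h1, h2⟩, h3⟩
    exact ⟨ts, ⟨h2, by omega⟩, h1.symm, rfl⟩
  · rintro ⟨ts', ⟨h1, h2⟩, h3, rfl⟩
    exact ⟨⟨h3.symm, h1⟩, by omega⟩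

theorem finite_beta01Trees {n : ℕ} (hn : 1 ≤ n) : (beta01Trees n).Finite := by
  obtain ⟨n, rfl⟩ : ∃ n', n = n' + 1 := ⟨n - 1, by omega⟩
  rw [beta01Trees_succ]
  exact (finite_forests n).image _

theorem ncard_beta01Trees {n : ℕ} (hn : 1 ≤ n) :
    ((beta01Trees n).ncard : ℚ) = coeff (n - 1) series := by
  obtain ⟨n, rfl⟩ : ∃ n', n = n' + 1 := ⟨n - 1, by omega⟩
  rw [beta01Trees_succ, Set.ncard_image_of_injective _ fun a b h => (node.inj h).2,
    Set.ncard_eq_toFinset_card _ (finite_forests n), Nat.add_sub_cancel, ← card_forestFinset]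
  rfl

end LabeledPlaneTree

/-! ### The bijection and the formula -/

theorem mainTheorem2 (n : ℕ) (hn : 1 ≤ n) :
    Nonempty (indecomposable1342Avoiders n ≃ beta01Trees n) ∧
    (n = 1 → (indecomposable1342Avoiders n).ncard = 1 ∧ (beta01Trees n).ncard = 1) ∧
    (2 ≤ n →
      ((indecomposable1342Avoiders n).ncard : ℚ) =
        3 * 2 ^ (n - 2) * ((2 * n - 2)! : ℚ) / (((n + 1)! : ℚ) * ((n - 1)! : ℚ)) ∧
      ((beta01Trees n).ncard : ℚ) =
        3 * 2 ^ (n - 2) * ((2 * n - 2)! : ℚ) / (((n + 1)! : ℚ) * ((n - 1)! : ℚ))) := by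
  have h1 := SlotState.ncard_indecomposable1342Avoiders hn
  have h2 := LabeledPlaneTree.ncard_beta01Trees hn
  refine ⟨?_, ?_, ?_⟩
  · have hf1 : Finite (indecomposable1342Avoiders n) := inferInstance
    have hf2 : Finite (beta01Trees n) := LabeledPlaneTree.finite_beta01Trees hn
    have h3 : (indecomposable1342Avoiders n).ncard = (beta01Trees n).ncard := by
      exact_mod_cast h1.trans h2.symm
    exact Finite.card_eq.1 h3
  · rintro rfl
    have h0 : PowerSeries.coeff (1 - 1) BicubicSeries.series = 1 := by
      simpa using BicubicSeries.constantCoeff_series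
    rw [h0] at h1 h2
    exact ⟨by exact_mod_cast h1, by exact_mod_cast h2⟩
  · intro hn2
    obtain ⟨m, rfl⟩ : ∃ m, n = m + 2 := ⟨n - 2, by omega⟩
    have h0 := BicubicSeries.coeff_series m
    rw [h1, h2, show m + 2 - 1 = m + 1 by omega, h0, show m + 2 - 2 = m by omega,
      show 2 * (m + 2) - 2 = 2 * (m + 1) by omega]
    exact ⟨rfl, rfl⟩
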